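/- Let $(\Omega,\mathcal F,\mathbb P)$ be an atomless probability space and let $\mathbb Q$ be a probability measure with $\mathbb Q\ll\mathbb P$. Positive values of a random variable are losses. For $X\in L^1$ let $\mathrm{VaR}_q(X)=\inf\{t\in\mathbb R:\mathbb P(X\le t)\ge q\}$ for $q\in(0,1]$, $\mathrm{ES}_p(X)=\frac1{1-p}\int_p^1\mathrm{VaR}_q(X)\,dq$ for $p\in[0,1)$ and $\mathrm{ES}_1(X)=\operatorname{ess\,sup}X$. We say that $X$ has ES profile $g$ if $\mathrm{ES}_p(X)=g(p)$ for all $p\in[0,1]$, and we write $X\ge_{\rm SSD}Y$ if $\mathbb E[v(-X)]\ge\mathbb E[v(-Y)]$ for every increasing concave $v:\mathbb R\to\mathbb R$. Let $\mathcal G_{\rm ES}$ be the set of increasing functions $g:[0,1]\to(-\infty,\infty]$ that are finite on $[0,1)$, left-continuous on $[0,1]$ and right-continuous at $0$, and such that $h_g(p)=(1-p)g(p)$ (with $0\cdot\infty=0$) is concave on $(0,1)$ and left-continuous at $1$. Let $g\in\mathcal G_{\rm ES}$ be such that $g(p)\le g(0)+Cp$ for all $p\in[0,1]$ and some constant $C\in\mathbb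 R$. Put $$\rho(X)=\mathrm{ES}^g(X)=\inf\{m\in\mathbb R:\ \mathrm{ES}_p(X-m)\le g(p)\ \ \forall p\in[0,1]\},\qquad X\in L^\infty .$$ Let $w,x\in\mathbb R$. Let $u:\mathbb R\to\mathbb R\cup\{-\infty\}$ be concave, increasing and right-continuous (the last condition only matters at the point where $u$ may become $-\infty$), and let $\rho':L^\infty\to[-\infty,\infty]$ be continuous for the $L^\infty$-norm and SSD-consistent, i.e. $\rho'(X)\le\rho'(Y)$ whenever $X\ge_{\rm SSD}Y$. Consider the following problems over $X\in L^\infty$: (A) minimize $\rho(X)$ subject to $\mathbb E_{\mathbb Q}[w-X]\le x$; (B) minimize $\mathbb E_{\mathbb Q}[w-X]$ subject to $\rho(X)\le x$; (C) minimize $\rho(X)$ subject to $\mathbb E[u(w-X)]=x$; (D) minimize $\mathbb E[u(w-X)]$ subject to $\rho(X)=x$; (E) maximize $\rho'(X)$ subject to $\rho(X)=x$. In (C) assume in addition that $\lim_{y\to-\infty}u(y)<x<\lim_{y\to\infty}u(y)$ and that, if $a:=\inf\{y:u(y)>-\infty\}$ is finite, then $\mathbb E[u(a+g(1)-Z)]\le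 x$ for $Z\in L^\infty$ with ES profile $g$ (this value depends only on the law of $Z$, which is determined by $g$). Then there is a $Z\in L^\infty$ that has ES profile $g$ and is comonotonic with $d\mathbb Q/d\mathbb P$. Moreover: (i) For every $Z\in L^\infty$ that has ES profile $g$ and is comonotonic with $d\mathbb Q/d\mathbb P$, there is exactly one $z\in\mathbb R$ with $\mathbb E_{\mathbb Q}[w-(Z+z)]=x$, and for this $z$ the position $Z+z$ is an optimal solution of (A); likewise there is exactly one $z\in\mathbb R$ with $\rho(Z+z)=x$, and for this $z$ the position $Z+z$ is an optimal solution of (B). (ii) For every $Z\in L^\infty$ that has ES profile $g$ and for each of the problems (C), (D), (E), there is exactly one $z\in\mathbb R$ for which $Z+z$ satisfies the constraint of the problem, and for this $z$ the position $Z+z$ is an optimal solution of the problem. -/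

import Mathlib

open MeasureTheory Set Filter Topology
open scoped ENNReal

noncomputable section

namespace AdjES

variable {Ω : Type*} [MeasurableSpace Ω]

/-- Every event of positive probability can be split into two events of positive probability. -/
def Atomless (P : Measure Ω) : Prop :=
  ∀ A : Set Ω, MeasurableSet A → 0 < P A →
    ∃ B : Set Ω, MeasurableSet B ∧ B ⊆ A ∧ 0 < P B ∧ P B < P A

/-- Value at Risk at level `p ∈ [0,1]` (left quantile; essential infimum for `p = 0`). -/
def VaR (P : Measure Ω) (p : ℝ) (X : Ω → ℝ) : EReal :=
  if p = 0 then essInf (fun ω => (X ω : EReal)) P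
  else sInf ((fun t : ℝ => (t : EReal)) '' {t : ℝ | ENNReal.ofReal p ≤ P {ω | X ω ≤ t}})

/-- Expected Shortfall at level `p ∈ [0,1]` of an integrable random variable
(essential supremum for `p = 1`). `VaR P q X` is finite for `0 < q < 1`. -/
def ES (P : Measure Ω) (p : ℝ) (X : Ω → ℝ) : EReal :=
  if p = 1 then essSup (fun ω => (X ω : EReal)) P
  else ((1 / (1 - p) * ∫ q in p..1, (VaR P q X).toReal : ℝ) : EReal)

/-- Risk profiles: increasing functions `[0,1] → (-∞,∞]` that are not identically `∞`.
Only the values on `[0,1]` matter. -/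
def IsProfile (g : ℝ → EReal) : Prop :=
  MonotoneOn g (Icc 0 1) ∧ (∀ p ∈ Icc (0 : ℝ) 1, g p ≠ ⊥) ∧ ∃ p ∈ Icc (0 : ℝ) 1, g p ≠ ⊤

/-- Finite on `[0,1)`, left-continuous on `[0,1]`, right-continuous at `0`. -/
def IsVaRProfile (g : ℝ → EReal) : Prop :=
  IsProfile g ∧ (∀ p ∈ Ico (0 : ℝ) 1, g p ≠ ⊤) ∧
    (∀ p ∈ Ioc (0 : ℝ) 1, ContinuousWithinAt g (Iio p) p) ∧
    ContinuousWithinAt g (Ioi 0) 0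

/-- `h_g(p) = (1 - p) g(p)`, with `0 * ∞ = 0`. -/
def hFun (g : ℝ → EReal) (p : ℝ) : EReal := ((1 - p : ℝ) : EReal) * g p

/-- The class of profiles for which moreover `h_g` is concave on `(0,1)` (where it is finite)
and left-continuous at `1`. -/
def IsESProfile (g : ℝ → EReal) : Prop :=
  IsVaRProfile g ∧ ConcaveOn ℝ (Ioo 0 1) (fun p => (hFun g p).toReal) ∧
    ContinuousWithinAt (hFun g) (Iio 1) 1

/-- The acceptance set of the `g`-adjusted Expected Shortfall. -/
def acceptSet (P : Measure Ω) (g : ℝ → EReal) : Set (Ω → ℝ) :=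
  {X | Integrable X P ∧ ∀ p ∈ Icc (0 : ℝ) 1, ES P p X ≤ g p}

/-- The `g`-adjusted Expected Shortfall; the infimum of the empty set is `∞`. -/
def adjES (P : Measure Ω) (g : ℝ → EReal) (X : Ω → ℝ) : EReal :=
  sInf ((fun m : ℝ => (m : EReal)) '' {m : ℝ | (fun ω => X ω - m) ∈ acceptSet P g})

/-- `X` has ES profile `g`. -/
def HasESProfile (P : Measure Ω) (X : Ω → ℝ) (g : ℝ → EReal) : Prop :=
  ∀ p ∈ Icc (0 : ℝ) 1, ES P p X = g p

/-- Comonotonicity (up to null sets): on an event of full measure, `Y ω < Y ω'` implies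
`X ω ≤ X ω'`. -/
def Comonotonic (P : Measure Ω) (X Y : Ω → ℝ) : Prop :=
  ∃ s ∈ ae P, MonovaryOn X Y s

/-- Expectation of an extended-real random variable, with `∞ - ∞ = -∞`. -/
def expE (P : Measure Ω) (f : Ω → EReal) : EReal :=
  ((∫⁻ ω, (f ω).toENNReal ∂P : ℝ≥0∞) : EReal) - ((∫⁻ ω, (-f ω).toENNReal ∂P : ℝ≥0∞) : EReal)

/-- Second-order stochastic dominance of losses: `SSD P X Y` means that every risk-averse agent
prefers the loss `X` to the loss `Y`. -/
def SSD (P : Measure Ω) (X Y : Ω → ℝ) : Prop :=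
  ∀ v : ℝ → ℝ, Monotone v → ConcaveOn ℝ univ v →
    expE P (fun ω => (v (-Y ω) : EReal)) ≤ expE P (fun ω => (v (-X ω) : EReal))

/-- Increasing concave functions `ℝ → ℝ ∪ {-∞}` that are right-continuous. (On the interior of
`{u > -∞}` and of `{u = -∞}` continuity is automatic.) -/
def IsUtility (u : ℝ → EReal) : Prop :=
  (∀ y, u y ≠ ⊤) ∧ Monotone u ∧
    (∀ y₁ y₂ t : ℝ, 0 < t → t < 1 →
      (t : EReal) * u y₁ + ((1 - t : ℝ) : EReal) * u y₂ ≤ u (t * y₁ + (1 - t) * y₂)) ∧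
    ∀ y, ContinuousWithinAt u (Ici y) y

/-- `a` minimizes `f` over the feasible set `S`. -/
def Minimizes {α : Type*} (f : α → EReal) (S : Set α) (a : α) : Prop :=
  a ∈ S ∧ ∀ b ∈ S, f a ≤ f b

/-- `a` maximizes `f` over the feasible set `S`. -/
def Maximizes {α : Type*} (f : α → EReal) (S : Set α) (a : α) : Prop :=
  a ∈ S ∧ ∀ b ∈ S, f b ≤ f a

/-- The space of essentially bounded random variables. -/
abbrev LInf (P : Measure Ω) := Lp ℝ ∞ P

/-- The price `E_Q[w - X]`. -/
def price {P : Measure Ω} (Q : Measure Ω) (w : ℝ) (X : LInf P) : ℝ := ∫ ω, (w - X ω) ∂Q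

/-- The expected utility `E[u(w - X)]`. -/
def expUtil {P : Measure Ω} (u : ℝ → EReal) (w : ℝ) (X : LInf P) : EReal :=
  expE P (fun ω => u (w - X ω))

/-- The adjusted Expected Shortfall on `L^∞`. -/
def rho {P : Measure Ω} (g : ℝ → EReal) (X : LInf P) : EReal := adjES P g X

/-- The position `Z + z`. -/
def shift {P : Measure Ω} [IsFiniteMeasure P] (Z : LInf P) (z : ℝ) : LInf P :=
  Z + Lp.const ∞ P z

end AdjES

end

open AdjES

/-! Write `tail P X p` for the integral of the quantile function over `(p, 1)`, which is `(1 - p)`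
times the Expected Shortfall. For bounded `X`, `ρ(X) ≤ m` means exactly that `tail P X p ≤ (1 - p) *
(g p + m)` for all `p`. When `Z` has ES profile `g`, the right-hand side is the tail of `Z + m`.
Hence `ρ(Z + m) = m`, and among all positions of risk at most `m` the position `Z + m` has the
largest tails. Optimality then reduces to showing that each objective is monotone in the order of
tails.

For prices this is a Hardy–Littlewood inequality (`integral_mul_le_of_tail_le`). The layer-cake
formula reduces `E[X D]`, with `D = dQ/dP`, to integrals of `X` over the sets `{D > t}`. Such an
integral is at most a tail of `X`, with equality if `X` is comonotonic with `D`.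

For utilities (`expE_utility_le_of_tail_le`), let `a`, `b` be the quantile functions of `X` and of
the dominating `W`, and `σ` a selection of supergradients of `u`. Then `u(w - b) ≤ u(w - a) + σ(w -
a) * (a - b)`. The weight `σ(w - a(q))` is nonnegative and increasing in `q`, so the same layer-cake
comparison makes the last term nonpositive after integration. SSD is the special case of finite `u`.

Existence of `Z`: the right derivative `φ` of `-(1 - p) g(p)` is increasing, and it is bounded
thanks to the growth condition on `g` (`RealProfile.exists_density`). Atomlessness provides a
uniform `U` of which `dQ/dP` is an increasing transform (`Atomless.exists_uniform`), and `Z = φ(U)`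
works.

In (C) it remains to solve the constraint (`IsUtility.existsUnique_shift`): `z ↦ E[u(w - Z - z)]` is
decreasing, concave and left-continuous, so the level `x` can only be missed by a jump to `-∞`,
which the extra hypothesis excludes. -/

noncomputable section

namespace AdjES

variable {Ω : Type*} [MeasurableSpace Ω] {P : Measure Ω} {X Y : Ω → ℝ}

/-! ### Quantiles -/

/-- The left quantile function, as a real number. -/
def quantile (P : Measure Ω) (X : Ω → ℝ) (q : ℝ) : ℝ := (VaR P q X).toReal

/-- Right-continuity of the distribution function makes the infimum attained. Its limits at `±∞`
make it finite for `0 < q < 1`. -/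
theorem isLeast_quantile [IsProbabilityMeasure P] (hX : AEMeasurable X P) {q : ℝ}
    (hq : q ∈ Ioo (0 : ℝ) 1) :
    IsLeast {t : ℝ | ENNReal.ofReal q ≤ P {ω | X ω ≤ t}} (quantile P X q) := by
  have := Measure.isProbabilityMeasure_map hX
  set F := ProbabilityTheory.cdf (P.map X) with hF
  have hS : ∀ t : ℝ, ENNReal.ofReal q ≤ P {ω | X ω ≤ t} ↔ q ≤ F t := by
    intro t
    rw [← ENNReal.ofReal_le_ofReal_iff (ProbabilityTheory.cdf_nonneg _ t),
      ProbabilityTheory.ofReal_cdf, Measure.map_apply_of_aemeasurable hX measurableSet_Iic]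
    rfl
  have hS' : {t : ℝ | ENNReal.ofReal q ≤ P {ω | X ω ≤ t}} = {t | q ≤ F t} := by
    ext t; exact hS t
  have hne : {t | q ≤ F t}.Nonempty :=
    (((ProbabilityTheory.tendsto_cdf_atTop (P.map X)).eventually
      (lt_mem_nhds hq.2)).exists).imp fun _ h => le_of_lt h
  have hbd : BddBelow {t | q ≤ F t} := by
    obtain ⟨b, hb⟩ := ((ProbabilityTheory.tendsto_cdf_atBot (P.map X)).eventually
      (gt_mem_nhds hq.1)).exists
    refine ⟨b, fun t ht => ?_⟩
    by_contra! h
    exact absurd (ht.trans (ProbabilityTheory.monotone_cdf _ h.le)) (not_le.2 hb)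
  have hleast : IsLeast {t | q ≤ F t} (sInf {t | q ≤ F t}) := by
    refine ⟨?_, fun t ht => csInf_le hbd ht⟩
    have hc : Tendsto F (𝓝[>] (sInf {t | q ≤ F t})) (𝓝 (F (sInf {t | q ≤ F t}))) :=
      (F.right_continuous _).mono Ioi_subset_Ici_self
    refine ge_of_tendsto hc ?_
    filter_upwards [self_mem_nhdsWithin] with t ht
    obtain ⟨s, hs, hst⟩ := exists_lt_of_csInf_lt hne ht
    exact le_trans hs (ProbabilityTheory.monotone_cdf _ hst.le)
  have heq : quantile P X q = sInf {t | q ≤ F t} := by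
    have h2 : IsLeast ((fun t : ℝ => (t : EReal)) '' {t | q ≤ F t})
        ((sInf {t | q ≤ F t} : ℝ) : EReal) :=
      ⟨⟨_, hleast.1, rfl⟩, by
        rintro _ ⟨t, ht, rfl⟩
        exact EReal.coe_le_coe_iff.2 (hleast.2 ht)⟩
    rw [quantile, VaR, if_neg hq.1.ne', hS', h2.isGLB.sInf_eq, EReal.toReal_coe]
  rw [hS', heq]
  exact hleast

theorem quantile_le_iff [IsProbabilityMeasure P] (hX : AEMeasurable X P) {q : ℝ}
    (hq : q ∈ Ioo (0 : ℝ) 1) (t : ℝ) :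
    quantile P X q ≤ t ↔ ENNReal.ofReal q ≤ P {ω | X ω ≤ t} := by
  have h := isLeast_quantile hX hq
  exact ⟨fun ht => h.1.trans (measure_mono fun ω hω => le_trans hω ht), fun ht => h.2 ht⟩

theorem monotoneOn_quantile [IsProbabilityMeasure P] (hX : AEMeasurable X P) :
    MonotoneOn (quantile P X) (Ioo 0 1) := fun p hp q hq hpq => by
  rw [quantile_le_iff hX hp]
  exact (ENNReal.ofReal_le_ofReal hpq).trans ((quantile_le_iff hX hq _).1 le_rfl)

theorem aemeasurable_quantile [IsProbabilityMeasure P] (hX : AEMeasurable X P) :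
    AEMeasurable (quantile P X) (volume.restrict (Ioo 0 1)) :=
  aemeasurable_restrict_of_monotoneOn measurableSet_Ioo (monotoneOn_quantile hX)

instance : IsProbabilityMeasure (volume.restrict (Ioo (0 : ℝ) 1)) :=
  ⟨by simp⟩

/-- By `quantile_le_iff`, `{q | quantile P X q ≤ t}` is `(0, P(X ≤ t)]` up to an endpoint. This
transfers expectations of functions of `X` to integrals over `(0, 1)`. -/
theorem map_quantile [IsProbabilityMeasure P] (hX : AEMeasurable X P) :
    (volume.restrict (Ioo 0 1)).map (quantile P X) = P.map X := by
  have h1 := Measure.isProbabilityMeasure_map hX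
  have h2 := Measure.isProbabilityMeasure_map (aemeasurable_quantile hX)
  refine Measure.ext_of_Iic _ _ fun t => ?_
  rw [Measure.map_apply_of_aemeasurable hX measurableSet_Iic,
    Measure.map_apply_of_aemeasurable (aemeasurable_quantile hX) measurableSet_Iic,
    Measure.restrict_apply' measurableSet_Ioo]
  have hlt : P {ω | X ω ≤ t} ≠ ∞ := measure_ne_top _ _
  have hle : (P {ω | X ω ≤ t}).toReal ≤ 1 :=
    ENNReal.toReal_le_of_le_ofReal zero_le_one (by simpa using prob_le_one)
  have : quantile P X ⁻¹' Iic t ∩ Ioo 0 1 = Ioc 0 (P {ω | X ω ≤ t}).toReal ∩ Ioo 0 1 := by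
    ext q
    simp only [mem_inter_iff, mem_preimage, mem_Iic, and_congr_left_iff]
    intro hq
    rw [quantile_le_iff hX hq, ENNReal.ofReal_le_iff_le_toReal hlt]
    exact ⟨fun h => ⟨hq.1, h⟩, fun h => h.2⟩
  rw [this]
  have h3 : volume (Ioc 0 (P {ω | X ω ≤ t}).toReal ∩ Ioo 0 1) =
      volume (Ioc 0 (P {ω | X ω ≤ t}).toReal ∩ Ioc 0 1) :=
    measure_congr ((ae_eq_refl _).inter Ioo_ae_eq_Ioc)
  rw [h3, inter_eq_left.2 (Ioc_subset_Ioc_right hle), Real.volume_Ioc, sub_zero,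
    ENNReal.ofReal_toReal hlt]
  rfl

theorem exists_ae_abs_le (hX : MemLp X ∞ P) : ∃ M : ℝ, 0 ≤ M ∧ ∀ᵐ ω ∂P, |X ω| ≤ M := by
  refine ⟨(eLpNorm X ∞ P).toReal, ENNReal.toReal_nonneg, ?_⟩
  have h := ae_le_eLpNormEssSup (f := X) (μ := P)
  filter_upwards [h] with ω hω
  rw [eLpNorm_exponent_top] at *
  have := (ENNReal.toReal_le_toReal (by simp) (by simpa using hX.2.ne)).2 hω
  simpa using this

theorem quantile_le_of_ae_le [IsProbabilityMeasure P] (hX : AEMeasurable X P) {M : ℝ}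
    (h : ∀ᵐ ω ∂P, X ω ≤ M) {q : ℝ} (hq : q ∈ Ioo (0 : ℝ) 1) : quantile P X q ≤ M := by
  rw [quantile_le_iff hX hq, measure_congr (eventuallyEq_univ.2 h), measure_univ]
  simpa using hq.2.le

/-! ### Tail integrals -/

theorem le_quantile_of_ae_le [IsProbabilityMeasure P] (hX : AEMeasurable X P) {M : ℝ}
    (h : ∀ᵐ ω ∂P, M ≤ X ω) {q : ℝ} (hq : q ∈ Ioo (0 : ℝ) 1) : M ≤ quantile P X q := by
  by_contra! hlt
  have h1 := (quantile_le_iff hX hq _).1 le_rfl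
  have h2 : P {ω | X ω ≤ quantile P X q} = 0 := by
    rw [measure_eq_zero_iff_ae_notMem]
    filter_upwards [h] with ω hω
    exact not_le.2 (hlt.trans_le hω)
  rw [h2] at h1
  exact absurd hq.1 (not_lt.2 (ENNReal.ofReal_eq_zero.1 (le_antisymm h1 bot_le)))

theorem exists_quantile_bound [IsProbabilityMeasure P] (hX : MemLp X ∞ P) :
    ∃ M : ℝ, 0 ≤ M ∧ ∀ q ∈ Ioo (0 : ℝ) 1, |quantile P X q| ≤ M := by
  obtain ⟨M, hM0, hM⟩ := exists_ae_abs_le hX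
  refine ⟨M, hM0, fun q hq => abs_le.2 ⟨?_, ?_⟩⟩
  · exact le_quantile_of_ae_le hX.1.aemeasurable (hM.mono fun ω h => (abs_le.1 h).1) hq
  · exact quantile_le_of_ae_le hX.1.aemeasurable (hM.mono fun ω h => (abs_le.1 h).2) hq

theorem memLp_quantile [IsProbabilityMeasure P] (hX : MemLp X ∞ P) :
    MemLp (quantile P X) ∞ (volume.restrict (Ioo 0 1)) := by
  obtain ⟨M, -, hM⟩ := exists_quantile_bound hX
  refine memLp_top_of_bound (aemeasurable_quantile hX.1.aemeasurable).aestronglyMeasurable M ?_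
  filter_upwards [ae_restrict_mem measurableSet_Ioo] with q hq using hM q hq

theorem integrableOn_quantile [IsProbabilityMeasure P] (hX : MemLp X ∞ P) :
    IntegrableOn (quantile P X) (Ioo 0 1) :=
  (memLp_quantile hX).integrable le_top

theorem lintegral_comp_quantile [IsProbabilityMeasure P] (hX : AEMeasurable X P) {f : ℝ → ℝ≥0∞}
    (hf : Measurable f) :
    ∫⁻ q in Ioo 0 1, f (quantile P X q) = ∫⁻ ω, f (X ω) ∂P := by
  rw [← lintegral_map' hf.aemeasurable hX, ← map_quantile hX,
    lintegral_map' hf.aemeasurable (aemeasurable_quantile hX)]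

theorem integral_comp_quantile [IsProbabilityMeasure P] (hX : AEMeasurable X P) {f : ℝ → ℝ}
    (hf : Measurable f) :
    ∫ q in Ioo 0 1, f (quantile P X q) = ∫ ω, f (X ω) ∂P := by
  rw [← integral_map hX hf.aestronglyMeasurable, ← map_quantile hX,
    integral_map (aemeasurable_quantile hX) hf.aestronglyMeasurable]

theorem VaR_congr (h : X =ᵐ[P] Y) (p : ℝ) : VaR P p X = VaR P p Y := by
  unfold VaR
  split_ifs
  · exact essInf_congr_ae (h.mono fun ω hω => by simp [hω])
  · have : ∀ t : ℝ, P {ω | X ω ≤ t} = P {ω | Y ω ≤ t} := fun t =>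
      measure_congr (h.mono fun ω hω => by
        change (X ω ≤ t) = (Y ω ≤ t)
        rw [hω])
    simp_rw [this]

theorem quantile_congr (h : X =ᵐ[P] Y) : quantile P X = quantile P Y :=
  funext fun p => by rw [quantile, quantile, VaR_congr h]

theorem ES_congr (h : X =ᵐ[P] Y) (p : ℝ) : ES P p X = ES P p Y := by
  unfold ES
  simp_rw [VaR_congr h]
  rw [essSup_congr_ae (h.mono fun ω hω => by simp [hω] : (fun ω => (X ω : EReal)) =ᵐ[P] fun ω => (Y ω : EReal))]

theorem quantile_add_const [IsProbabilityMeasure P] (hX : AEMeasurable X P) (c : ℝ) {q : ℝ}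
    (hq : q ∈ Ioo (0 : ℝ) 1) :
    quantile P (fun ω => X ω + c) q = quantile P X q + c := by
  refine eq_of_forall_ge_iff fun t => ?_
  rw [quantile_le_iff (hX.add_const c) hq, ← le_sub_iff_add_le, quantile_le_iff hX hq]
  simp_rw [le_sub_iff_add_le]

/-- The integral of the upper quantiles. -/
def tail (P : Measure Ω) (X : Ω → ℝ) (p : ℝ) : ℝ := ∫ q in Ioo p 1, quantile P X q

theorem ES_eq_tail {p : ℝ} (hp : p < 1) : ES P p X = ((tail P X p / (1 - p) : ℝ) : EReal) := by
  rw [ES, if_neg hp.ne, intervalIntegral.integral_of_le hp.le, integral_Ioc_eq_integral_Ioo, tail,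
    one_div_mul_eq_div]
  rfl

theorem tail_congr (h : X =ᵐ[P] Y) : tail P X = tail P Y :=
  funext fun p => by rw [tail, tail, quantile_congr h]

theorem tail_one : tail P X 1 = 0 := by simp [tail]

theorem tail_add_const [IsProbabilityMeasure P] (hX : MemLp X ∞ P) (c : ℝ) {p : ℝ}
    (hp : p ∈ Icc (0 : ℝ) 1) :
    tail P (fun ω => X ω + c) p = tail P X p + (1 - p) * c := by
  have hsub : Ioo p 1 ⊆ Ioo 0 1 := Ioo_subset_Ioo_left hp.1
  rw [tail, setIntegral_congr_fun measurableSet_Ioo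
    fun q hq => quantile_add_const hX.1.aemeasurable c (hsub hq),
    integral_add ((integrableOn_quantile hX).mono_set hsub) (by simp)]
  simp [tail, hp.2]

/-- One half of the Rockafellar–Uryasev formula, from `t ≤ s + (t - s)⁺` applied to quantiles.
Equality holds when `s` is the `p`-quantile, see `tail_eq_at_quantile`. -/
theorem tail_le [IsProbabilityMeasure P] (hX : MemLp X ∞ P) (s : ℝ) {p : ℝ}
    (hp : p ∈ Icc (0 : ℝ) 1) :
    tail P X p ≤ (1 - p) * s + ∫ ω, max (X ω - s) 0 ∂P := by
  have hsub : Ioo p 1 ⊆ Ioo 0 1 := Ioo_subset_Ioo_left hp.1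
  have hi := integrableOn_quantile hX
  have hi2 : IntegrableOn (fun q => max (quantile P X q - s) 0) (Ioo 0 1) :=
    (hi.sub (integrable_const s)).pos_part
  rw [← integral_comp_quantile hX.1.aemeasurable (f := fun t => max (t - s) 0) (by fun_prop)]
  calc tail P X p ≤ ∫ q in Ioo p 1, (s + max (quantile P X q - s) 0) := by
        refine setIntegral_mono (hi.mono_set hsub)
          ((integrable_const s).add (hi2.mono_set hsub)) fun q => ?_
        dsimp only
        linarith [le_max_left (quantile P X q - s) 0]
    _ = (1 - p) * s + ∫ q in Ioo p 1, max (quantile P X q - s) 0 := by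
        rw [integral_add (by simp) (hi2.mono_set hsub)]
        simp [hp.2]
    _ ≤ _ := by
        gcongr
        exact Eventually.of_forall fun q => le_max_right _ _

theorem tail_eq_at_quantile [IsProbabilityMeasure P] (hX : MemLp X ∞ P) {p : ℝ}
    (hp : p ∈ Ioo (0 : ℝ) 1) :
    tail P X p = (1 - p) * quantile P X p + ∫ ω, max (X ω - quantile P X p) 0 ∂P := by
  have hi := integrableOn_quantile hX
  have hsub : Ioo p 1 ⊆ Ioo 0 1 := Ioo_subset_Ioo_left hp.1.le
  have hmono := monotoneOn_quantile hX.1.aemeasurable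
  rw [← integral_comp_quantile hX.1.aemeasurable (f := fun t => max (t - quantile P X p) 0)
    (by fun_prop)]
  have h1 : ∫ q in Ioo 0 1, max (quantile P X q - quantile P X p) 0 =
      ∫ q in Ioo p 1, (quantile P X q - quantile P X p) := by
    rw [← integral_indicator measurableSet_Ioo, ← integral_indicator measurableSet_Ioo]
    congr 1
    ext q
    by_cases h : q ∈ Ioo p 1
    · rw [indicator_of_mem h, indicator_of_mem (hsub h),
        max_eq_left (sub_nonneg.2 (hmono hp (hsub h) h.1.le))]
    · rw [indicator_of_notMem h]
      by_cases h' : q ∈ Ioo (0 : ℝ) 1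
      · rw [indicator_of_mem h']
        refine max_eq_right (sub_nonpos.2 (hmono h' hp ?_))
        by_contra! h2
        exact h ⟨h2, h'.2⟩
      · rw [indicator_of_notMem h']
  rw [h1, integral_sub (hi.mono_set hsub) (by simp)]
  simp [tail, hp.2.le]

/-- Integrate `X ≤ s + (X - s)⁺` over `A`, with `s` the quantile at level `1 - P(A)`, where the
formula for the tail is an equality. The null and full cases are separate because the quantile
formula needs an interior level. -/
theorem setIntegral_le_tail [IsProbabilityMeasure P] (hX : MemLp X ∞ P) {A : Set Ω}
    (hA : MeasurableSet A) : ∫ ω in A, X ω ∂P ≤ tail P X (1 - P.real A) := by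
  have hXi := hX.integrable le_top
  rcases eq_or_lt_of_le (measureReal_nonneg (μ := P) (s := A)) with h0 | h0
  · rw [← h0, sub_zero, tail_one, setIntegral_measure_zero]
    rwa [eq_comm, measureReal_eq_zero_iff] at h0
  rcases eq_or_lt_of_le (measureReal_le_one (μ := P) (s := A)) with h1 | h1
  · rw [h1, sub_self]
    have : ∀ᵐ ω ∂P, ω ∈ A := by
      rw [ae_mem_iff_measure_eq hA.nullMeasurableSet]
      rw [measureReal_def, ENNReal.toReal_eq_one_iff] at h1
      simpa using h1
    rw [Measure.restrict_eq_self_of_ae_mem this, tail]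
    exact (integral_comp_quantile hX.1.aemeasurable measurable_id).ge
  have hp : 1 - P.real A ∈ Ioo (0 : ℝ) 1 := ⟨by linarith, by linarith⟩
  rw [tail_eq_at_quantile hX hp]
  set s := quantile P X (1 - P.real A)
  have hpi : Integrable (fun ω => max (X ω - s) 0) P := (hXi.sub (integrable_const s)).pos_part
  calc ∫ ω in A, X ω ∂P ≤ ∫ ω in A, (s + max (X ω - s) 0) ∂P := by
        refine integral_mono hXi.integrableOn ((integrable_const s).add hpi.integrableOn)
          fun ω => ?_
        dsimp only
        linarith [le_max_left (X ω - s) 0]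
    _ = P.real A * s + ∫ ω in A, max (X ω - s) 0 ∂P := by
        rw [integral_add (integrable_const s) hpi.integrableOn]
        simp
    _ ≤ _ := by
        rw [sub_sub_cancel]
        gcongr
        · exact Eventually.of_forall fun q => le_max_right _ _
        · exact Measure.restrict_le_self

/-- If, up to null sets, `X` is larger on `A` than outside `A`, then the integral of `X` over `A`
is an integral of upper quantiles. -/
theorem setIntegral_eq_tail [IsProbabilityMeasure P] (hX : MemLp X ∞ P) {A : Set Ω}
    (hA : MeasurableSet A) {S : Set Ω} (hS : S ∈ ae P)
    (h : ∀ ω ∈ A ∩ S, ∀ ω' ∈ S \ A, X ω' ≤ X ω) :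
    ∫ ω in A, X ω ∂P = tail P X (1 - P.real A) := by
  refine le_antisymm (setIntegral_le_tail hX hA) ?_
  obtain ⟨M, -, hM⟩ := exists_ae_abs_le hX
  replace hS : S ∩ {ω | |X ω| ≤ M} ∈ ae P := inter_mem hS hM
  replace h : ∀ ω ∈ A ∩ (S ∩ {ω | |X ω| ≤ M}), ∀ ω' ∈ (S ∩ {ω | |X ω| ≤ M}) \ A, X ω' ≤ X ω :=
    fun ω hω ω' hω' => h ω ⟨hω.1, hω.2.1⟩ ω' ⟨hω'.1.1, hω'.2⟩
  have hlow : ∀ ω ∈ S ∩ {ω | |X ω| ≤ M}, -M ≤ X ω := fun ω hω => (abs_le.1 hω.2).1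
  generalize S ∩ {ω | |X ω| ≤ M} = S at hS h hlow
  have hXi := hX.integrable le_top
  rcases eq_or_lt_of_le (measureReal_nonneg (μ := P) (s := A)) with h0 | h0
  · rw [← h0, sub_zero, tail_one, setIntegral_measure_zero]
    rwa [eq_comm, measureReal_eq_zero_iff] at h0
  have hp : 1 - P.real A ∈ Icc (0 : ℝ) 1 :=
    ⟨by linarith [measureReal_le_one (μ := P) (s := A)], by linarith⟩
  have hne : (A ∩ S).Nonempty := by
    by_contra hemp
    rw [not_nonempty_iff_eq_empty] at hemp
    have : A ⊆ Sᶜ := fun ω hω hS => (hemp ▸ (⟨hω, hS⟩ : ω ∈ A ∩ S) : ω ∈ (∅ : Set Ω))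
    have := measure_mono_null this (mem_ae_iff.1 hS)
    simp [measureReal_def, this] at h0
  obtain ⟨ω₀, hω₀⟩ := hne
  -- A level `s` separating the values of `X` on `A` from those off `A`, so that `(X - s)⁺` is `X -
  -- s` on `A` and zero elsewhere. If nothing lies off `A`, any lower bound of `X` serves.
  obtain ⟨s, hs1, hs2⟩ : ∃ s, (∀ ω ∈ A ∩ S, s ≤ X ω) ∧ ∀ ω ∈ S \ A, X ω ≤ s := by
    rcases (S \ A).eq_empty_or_nonempty with he | hne
    · exact ⟨-M, fun ω hω => hlow ω hω.2, by simp [he]⟩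
    · exact ⟨sSup (X '' (S \ A)), fun ω hω => csSup_le (hne.image _)
        (by rintro _ ⟨ω', hω', rfl⟩; exact h ω hω ω' hω'),
        fun ω hω => le_csSup ⟨X ω₀, by rintro _ ⟨ω', hω', rfl⟩; exact h ω₀ hω₀ ω' hω'⟩
          (mem_image_of_mem _ hω)⟩
  have hpi : Integrable (fun ω => max (X ω - s) 0) P := (hXi.sub (integrable_const s)).pos_part
  have key : ∫ ω, max (X ω - s) 0 ∂P = ∫ ω in A, (X ω - s) ∂P := by
    rw [← integral_indicator hA]
    refine integral_congr_ae ?_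
    filter_upwards [hS] with ω hω
    by_cases hωA : ω ∈ A
    · rw [indicator_of_mem hωA]
      exact max_eq_left (sub_nonneg.2 (hs1 ω ⟨hωA, hω⟩))
    · rw [indicator_of_notMem hωA]
      exact max_eq_right (sub_nonpos.2 (hs2 ω ⟨hω, hωA⟩))
  refine (tail_le hX s hp).trans ?_
  rw [key, integral_sub hXi.integrableOn (integrable_const s)]
  simp

/-! ### A layer-cake comparison -/

/-- Layer-cake formula for `D` under the measure with density `c`: the integral of `c * D` is the
integral over `t > 0` of the integrals of `c` over `{D > t}`. -/
theorem lintegral_mul_le_of_superlevel {α : Type*} [MeasurableSpace α] {μ : Measure α}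
    [IsFiniteMeasure μ] {D : α → ℝ} (hD : AEMeasurable D μ) (hD0 : ∀ᵐ y ∂μ, 0 ≤ D y)
    {a b : α → ℝ≥0∞} (ha : AEMeasurable a μ) (hb : AEMeasurable b μ)
    (h : ∀ t : ℝ, 0 < t → ∫⁻ y in {y | t < D y}, a y ∂μ ≤ ∫⁻ y in {y | t < D y}, b y ∂μ) :
    ∫⁻ y, a y * ENNReal.ofReal (D y) ∂μ ≤ ∫⁻ y, b y * ENNReal.ofReal (D y) ∂μ := by
  have key : ∀ c : α → ℝ≥0∞, AEMeasurable c μ → ∫⁻ y, c y * ENNReal.ofReal (D y) ∂μ =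
      ∫⁻ t in Ioi (0 : ℝ), ∫⁻ y in {y | t < D y}, c y ∂μ := by
    intro c hc
    have hac := withDensity_absolutelyContinuous μ c
    have h1 := lintegral_eq_lintegral_meas_lt (μ.withDensity c) (hac.ae_le hD0) (hD.mono_ac hac)
    simp_rw [withDensity_apply'] at h1
    rw [← h1, lintegral_withDensity_eq_lintegral_mul₀ hc hD.ennreal_ofReal]
    rfl
  rw [key a ha, key b hb]
  exact setLIntegral_mono' measurableSet_Ioi fun t ht => h t ht

/-- Adding a common constant `M` makes both functions nonnegative; its contribution is the same on
both sides and cancels. -/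
theorem integral_mul_le_of_superlevel {α : Type*} [MeasurableSpace α] {μ : Measure α}
    [IsFiniteMeasure μ] {D : α → ℝ} (hD : Integrable D μ) (hD0 : ∀ᵐ y ∂μ, 0 ≤ D y)
    {a b : α → ℝ} (ha : MemLp a ∞ μ) (hb : MemLp b ∞ μ)
    (h : ∀ t : ℝ, 0 < t → ∫ y in {y | t < D y}, a y ∂μ ≤ ∫ y in {y | t < D y}, b y ∂μ) :
    ∫ y, a y * D y ∂μ ≤ ∫ y, b y * D y ∂μ := by
  obtain ⟨A, hA0, hA⟩ := exists_ae_abs_le ha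
  obtain ⟨B, hB0, hB⟩ := exists_ae_abs_le hb
  set M := max A B
  have hai := ha.integrable le_top
  have hbi := hb.integrable le_top
  have hM : Integrable (fun _ : α => M) μ := integrable_const M
  have ha0 : ∀ᵐ y ∂μ, 0 ≤ a y + M := hA.mono fun y hy => by
    linarith [(abs_le.1 hy).1, le_max_left A B]
  have hb0 : ∀ᵐ y ∂μ, 0 ≤ b y + M := hB.mono fun y hy => by
    linarith [(abs_le.1 hy).1, le_max_right A B]
  have h1 := lintegral_mul_le_of_superlevel hD.1.aemeasurable hD0
    (a := fun y => ENNReal.ofReal (a y + M)) (b := fun y => ENNReal.ofReal (b y + M))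
    (hai.add hM).1.aemeasurable.ennreal_ofReal (hbi.add hM).1.aemeasurable.ennreal_ofReal (by
      intro t ht
      rw [← ofReal_integral_eq_lintegral_ofReal (f := fun y => a y + M) (hai.add hM).integrableOn
          (ae_restrict_of_ae ha0),
        ← ofReal_integral_eq_lintegral_ofReal (f := fun y => b y + M) (hbi.add hM).integrableOn
          (ae_restrict_of_ae hb0)]
      refine ENNReal.ofReal_le_ofReal ?_
      rw [integral_add hai.integrableOn hM.integrableOn,
        integral_add hbi.integrableOn hM.integrableOn]
      exact add_le_add_left (h t ht) _)
  have haD : Integrable (fun y => a y * D y) μ := hD.bdd_mul ha.1 hA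
  have hbD : Integrable (fun y => b y * D y) μ := hD.bdd_mul hb.1 hB
  have hi : ∀ c : α → ℝ, Integrable (fun y => c y * D y) μ →
      Integrable (fun y => (c y + M) * D y) μ := fun c hc => by
    simp_rw [add_mul]
    exact hc.add (hD.const_mul M)
  have h2 : ∀ c : α → ℝ, Integrable (fun y => c y * D y) μ → (∀ᵐ y ∂μ, 0 ≤ c y + M) →
      ∫⁻ y, ENNReal.ofReal (c y + M) * ENNReal.ofReal (D y) ∂μ =
      ENNReal.ofReal (∫ y, (c y + M) * D y ∂μ) := by
    intro c hc hc0
    rw [ofReal_integral_eq_lintegral_ofReal (hi c hc)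
      (by filter_upwards [hc0, hD0] with y h1 h2 using mul_nonneg h1 h2)]
    refine lintegral_congr_ae ?_
    filter_upwards [hc0] with y hy
    rw [ENNReal.ofReal_mul hy]
  rw [h2 a haD ha0, h2 b hbD hb0, ENNReal.ofReal_le_ofReal_iff
    (integral_nonneg_of_ae (by filter_upwards [hb0, hD0] with y h1 h2 using mul_nonneg h1 h2))]
    at h1
  simp_rw [add_mul] at h1
  rw [integral_add haD (hD.const_mul M), integral_add hbD (hD.const_mul M)] at h1
  linarith

/-- The Hardy–Littlewood inequality: pairing with a nonnegative density is maximal for a comonotonic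
position, among all positions with smaller tail integrals. -/
theorem integral_mul_le_of_tail_le [IsProbabilityMeasure P] {D Z : Ω → ℝ} (hX : MemLp X ∞ P)
    (hZ : MemLp Z ∞ P) (hD : Integrable D P) (hDm : Measurable D) (hD0 : ∀ᵐ ω ∂P, 0 ≤ D ω)
    (hZD : Comonotonic P Z D) (h : ∀ p ∈ Icc (0 : ℝ) 1, tail P X p ≤ tail P Z p) :
    ∫ ω, X ω * D ω ∂P ≤ ∫ ω, Z ω * D ω ∂P := by
  refine integral_mul_le_of_superlevel hD hD0 hX hZ fun t _ => ?_
  obtain ⟨S, hS, hmono⟩ := hZD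
  have hA : MeasurableSet {ω | t < D ω} := measurableSet_lt measurable_const hDm
  rw [setIntegral_eq_tail hZ hA hS fun ω hω ω' hω' =>
    hmono hω'.1 hω.2 ((not_lt.1 hω'.2).trans_lt hω.1)]
  refine (setIntegral_le_tail hX hA).trans (h _ ⟨?_, ?_⟩)
  · linarith [measureReal_le_one (μ := P) (s := {ω | t < D ω})]
  · linarith [measureReal_nonneg (μ := P) (s := {ω | t < D ω})]

/-! ### Upper bounds and tails -/

theorem tail_le_of_ae_le [IsProbabilityMeasure P] (hX : MemLp X ∞ P) {M : ℝ}
    (h : ∀ᵐ ω ∂P, X ω ≤ M) {p : ℝ} (hp : p ∈ Icc (0 : ℝ) 1) : tail P X p ≤ (1 - p) * M := by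
  have hsub : Ioo p 1 ⊆ Ioo 0 1 := Ioo_subset_Ioo_left hp.1
  calc tail P X p ≤ ∫ q in Ioo p 1, M :=
        setIntegral_mono_on ((integrableOn_quantile hX).mono_set hsub) (by simp)
          measurableSet_Ioo fun q hq => quantile_le_of_ae_le hX.1.aemeasurable h (hsub hq)
    _ = _ := by simp [hp.2]

theorem mul_quantile_le_tail [IsProbabilityMeasure P] (hX : MemLp X ∞ P) {p : ℝ}
    (hp : p ∈ Ioo (0 : ℝ) 1) : (1 - p) * quantile P X p ≤ tail P X p := by
  rw [tail_eq_at_quantile hX hp]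
  have : 0 ≤ ∫ ω, max (X ω - quantile P X p) 0 ∂P :=
    integral_nonneg fun ω => le_max_right _ _
  linarith

theorem ae_le_of_quantile_le [IsProbabilityMeasure P] (hX : AEMeasurable X P) {M : ℝ}
    (h : ∀ p ∈ Ioo (0 : ℝ) 1, quantile P X p ≤ M) : ∀ᵐ ω ∂P, X ω ≤ M := by
  have hnull : NullMeasurableSet {ω | X ω ≤ M} P := nullMeasurableSet_le hX aemeasurable_const
  refine (prob_compl_eq_zero_iff₀ hnull).2 (le_antisymm prob_le_one ?_)
  by_contra! hlt
  rw [← ofReal_measureReal, ENNReal.ofReal_lt_one] at hlt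
  have h0 := measureReal_nonneg (μ := P) (s := {ω | X ω ≤ M})
  -- A level strictly between `P(X ≤ M)` and 1, whose quantile would have to exceed `M`.
  have hq : (P.real {ω | X ω ≤ M} + 1) / 2 ∈ Ioo (0 : ℝ) 1 := ⟨by linarith, by linarith⟩
  have h1 := (quantile_le_iff hX hq M).1 (h _ hq)
  rw [← ofReal_measureReal, ENNReal.ofReal_le_ofReal_iff h0] at h1
  linarith

theorem ae_le_of_tail_le [IsProbabilityMeasure P] (hX : MemLp X ∞ P) {M : ℝ}
    (h : ∀ p ∈ Ioo (0 : ℝ) 1, tail P X p ≤ (1 - p) * M) : ∀ᵐ ω ∂P, X ω ≤ M :=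
  ae_le_of_quantile_le hX.1.aemeasurable fun p hp =>
    le_of_mul_le_mul_left ((mul_quantile_le_tail hX hp).trans (h p hp)) (by linarith [hp.2])

theorem ES_one_le_iff [IsProbabilityMeasure P] {M : ℝ} :
    ES P 1 X ≤ (M : EReal) ↔ ∀ᵐ ω ∂P, X ω ≤ M := by
  rw [ES, if_pos rfl]
  refine ⟨fun h => ?_, fun h => essSup_le_of_ae_le _ (h.mono fun ω hω => ?_)⟩
  · filter_upwards [ae_le_essSup (f := fun ω => (X ω : EReal)) (μ := P)] with ω hω
    exact EReal.coe_le_coe_iff.1 (hω.trans h)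
  · exact EReal.coe_le_coe_iff.2 hω

/-! ### Expectations of extended-real random variables -/

theorem expE_mono {f g : Ω → EReal} (h : ∀ᵐ ω ∂P, f ω ≤ g ω) : expE P f ≤ expE P g := by
  unfold expE
  refine EReal.sub_le_sub ?_ ?_
  · exact EReal.coe_ennreal_le_coe_ennreal_iff.2
      (lintegral_mono_ae (h.mono fun ω hω => EReal.toENNReal_le_toENNReal hω))
  · exact EReal.coe_ennreal_le_coe_ennreal_iff.2
      (lintegral_mono_ae (h.mono fun ω hω => EReal.toENNReal_le_toENNReal (EReal.neg_le_neg_iff.2 hω)))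

theorem expE_congr {f g : Ω → EReal} (h : f =ᵐ[P] g) : expE P f = expE P g :=
  le_antisymm (expE_mono h.le) (expE_mono h.symm.le)

theorem expE_coe {f : Ω → ℝ} (hf : Integrable f P) :
    expE P (fun ω => (f ω : EReal)) = ((∫ ω, f ω ∂P : ℝ) : EReal) := by
  have h1 : ∫⁻ ω, ENNReal.ofReal (f ω) ∂P ≠ ∞ := Integrable.lintegral_lt_top hf |>.ne
  have h2 : ∫⁻ ω, ENNReal.ofReal (-f ω) ∂P ≠ ∞ := Integrable.lintegral_lt_top hf.neg |>.ne
  rw [integral_eq_lintegral_pos_part_sub_lintegral_neg_part hf, EReal.coe_sub, expE]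
  simp_rw [← EReal.coe_neg, EReal.real_coe_toENNReal]
  rw [EReal.coe_ennreal_toReal h1, EReal.coe_ennreal_toReal h2]

theorem expE_const [IsProbabilityMeasure P] (c : EReal) : expE P (fun _ => c) = c := by
  unfold expE
  rw [lintegral_const, lintegral_const, measure_univ, mul_one, mul_one]
  rcases le_total 0 c with h | h
  · rw [EReal.coe_toENNReal h, EReal.toENNReal_of_nonpos (by simpa using h)]
    simp
  · rw [EReal.toENNReal_of_nonpos h, EReal.coe_toENNReal (by simpa using h)]
    simp

theorem ne_bot_of_expE_ne_bot {f : Ω → EReal} (hf : AEMeasurable f P) (h : expE P f ≠ ⊥) :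
    ∀ᵐ ω ∂P, f ω ≠ ⊥ := by
  have : ∫⁻ ω, (-f ω).toENNReal ∂P ≠ ∞ := by
    intro htop
    apply h
    simp [expE, htop]
  filter_upwards [ae_lt_top' (by fun_prop) this] with ω hω hbot
  simp [hbot] at hω

theorem expE_comp_quantile [IsProbabilityMeasure P] (hX : AEMeasurable X P) {f : ℝ → EReal}
    (hf : Measurable f) :
    expE (volume.restrict (Ioo 0 1)) (fun q => f (quantile P X q)) =
      expE P (fun ω => f (X ω)) := by
  unfold expE
  rw [lintegral_comp_quantile hX (f := fun t => (f t).toENNReal) (by fun_prop),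
    lintegral_comp_quantile hX (f := fun t => (-f t).toENNReal) (by fun_prop)]

/-- Dominated convergence for the positive parts, monotone convergence for the negative parts. The
limit may be `-∞`; subtraction stays continuous there because the positive part has finite
expectation. -/
theorem tendsto_expE_of_antitone [IsFiniteMeasure P] {f : ℕ → Ω → EReal} {F : Ω → EReal} {M : ℝ}
    (hf : ∀ n, AEMeasurable (f n) P) (hM : ∀ n, ∀ᵐ ω ∂P, f n ω ≤ M)
    (hanti : ∀ᵐ ω ∂P, Antitone fun n => f n ω)
    (hlim : ∀ᵐ ω ∂P, Tendsto (fun n => f n ω) atTop (𝓝 (F ω))) :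
    Tendsto (fun n => expE P (f n)) atTop (𝓝 (expE P F)) := by
  have hFM : ∀ᵐ ω ∂P, F ω ≤ M := by
    filter_upwards [hlim, ae_all_iff.2 hM] with ω h1 h2
    exact le_of_tendsto' h1 h2
  have h1 : Tendsto (fun n => ∫⁻ ω, (f n ω).toENNReal ∂P) atTop
      (𝓝 (∫⁻ ω, (F ω).toENNReal ∂P)) := by
    refine tendsto_lintegral_of_dominated_convergence' (fun _ => ENNReal.ofReal M)
      (fun n => (hf n).ereal_toENNReal) (fun n => (hM n).mono fun ω h => ?_) (by simp [ENNReal.mul_eq_top]) ?_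
    · exact EReal.toENNReal_le_toENNReal h
    · filter_upwards [hlim] with ω h
      exact (EReal.continuous_toENNReal.tendsto _).comp h
  have h2 : Tendsto (fun n => ∫⁻ ω, (-f n ω).toENNReal ∂P) atTop
      (𝓝 (∫⁻ ω, (-F ω).toENNReal ∂P)) := by
    refine lintegral_tendsto_of_tendsto_of_monotone (fun n => (hf n).neg.ereal_toENNReal)
      (hanti.mono fun ω h m n hmn =>
        EReal.toENNReal_le_toENNReal (EReal.neg_le_neg_iff.2 (h hmn))) ?_
    filter_upwards [hlim] with ω h
    exact (EReal.continuous_toENNReal.tendsto _).comp ((continuous_neg.tendsto _).comp h)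
  have hfin : ∫⁻ ω, (F ω).toENNReal ∂P ≠ ∞ := by
    refine ne_top_of_le_ne_top ?_ (lintegral_mono_ae (hFM.mono fun ω h =>
      EReal.toENNReal_le_toENNReal h))
    simp [ENNReal.mul_eq_top]
  unfold expE
  simp_rw [sub_eq_add_neg]
  refine (EReal.continuousAt_add (p := (_, _)) ?_ ?_).tendsto.comp
    (((continuous_coe_ennreal_ereal.tendsto _).comp h1).prodMk_nhds
      ((continuous_neg.tendsto _).comp ((continuous_coe_ennreal_ereal.tendsto _).comp h2)))
  · left; simpa using hfin
  · left; simp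

/-! ### Stochastic dominance -/

section Utility

variable {u : ℝ → EReal}

theorem IsUtility.coe_toReal (hu : IsUtility u) {y : ℝ} (hy : u y ≠ ⊥) :
    ((u y).toReal : EReal) = u y := EReal.coe_toReal (hu.1 y) hy

theorem IsUtility.ne_bot_of_le (hu : IsUtility u) {y z : ℝ} (hy : u y ≠ ⊥) (h : y ≤ z) :
    u z ≠ ⊥ := fun hz => hy (le_bot_iff.1 (hz ▸ hu.2.1 h))

theorem IsUtility.toReal_le_toReal (hu : IsUtility u) {y z : ℝ} (hy : u y ≠ ⊥) (h : y ≤ z) :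
    (u y).toReal ≤ (u z).toReal :=
  EReal.toReal_le_toReal (hu.2.1 h) hy (hu.1 z)

theorem IsUtility.concaveOn_toReal (hu : IsUtility u) :
    ConcaveOn ℝ {y | u y ≠ ⊥} (fun y => (u y).toReal) := by
  have hconv : Convex ℝ {y | u y ≠ ⊥} :=
    (OrdConnected.mk fun y hy z _ t ht => hu.ne_bot_of_le hy ht.1).convex
  refine ⟨hconv, fun y hy z hz a b ha hb hab => ?_⟩
  rcases ha.eq_or_lt with rfl | ha
  · obtain rfl : b = 1 := by linarith
    simp
  rcases hb.eq_or_lt with rfl | hb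
  · obtain rfl : a = 1 := by linarith
    simp
  have h := hu.2.2.1 y z a ha (by linarith)
  obtain rfl : b = 1 - a := by linarith
  change _ ≤ u (a • y + (1 - a) • z) at h
  rw [← hu.coe_toReal hy, ← hu.coe_toReal hz, ← hu.coe_toReal (hconv hy hz ha.le hb.le hab)] at h
  exact_mod_cast h

theorem IsUtility.mem_interior (hu : IsUtility u) {y z : ℝ} (hy : u y ≠ ⊥) (h : y < z) :
    z ∈ interior {y | u y ≠ ⊥} :=
  _root_.mem_interior.2 ⟨Ioi y, fun _ ht => hu.ne_bot_of_le hy (le_of_lt ht), isOpen_Ioi, h⟩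

theorem IsUtility.mem_interior_of_le (hu : IsUtility u) {y z : ℝ}
    (hy : y ∈ interior {y | u y ≠ ⊥}) (h : y ≤ z) : z ∈ interior {y | u y ≠ ⊥} := by
  rcases h.eq_or_lt with rfl | h
  · exact hy
  · exact hu.mem_interior (interior_subset hy) h

/-- A concave increasing function has a decreasing nonnegative selection of supergradients on the
interior of its domain. -/
theorem IsUtility.exists_supergradient (hu : IsUtility u) :
    ∃ σ : ℝ → ℝ, AntitoneOn σ (interior {y | u y ≠ ⊥}) ∧
      (∀ y ∈ interior {y | u y ≠ ⊥}, 0 ≤ σ y) ∧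
      ∀ y ∈ interior {y | u y ≠ ⊥}, ∀ z,
        u z ≤ (((u y).toReal + σ y * (z - y) : ℝ) : EReal) := by
  set k : ℝ → ℝ := -fun y => (u y).toReal with hk
  have hconv : ConvexOn ℝ {y | u y ≠ ⊥} k := hu.concaveOn_toReal.neg
  -- Minus the right derivative of the convex function `-u`. Off the domain of `u` the supergradient
  -- inequality is trivial, its left side being `⊥`.
  refine ⟨fun y => -derivWithin k (Ioi y) y, fun y hy z hz hyz => ?_, fun y hy => ?_,
    fun y hy z => ?_⟩
  · exact neg_le_neg (hconv.monotoneOn_rightDeriv hy hz hyz)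
  · have hy' := interior_subset hy
    have h1 := hconv.rightDeriv_le_slope_of_mem_interior hy
      (hu.ne_bot_of_le hy' (by linarith : y ≤ y + 1)) (by linarith : y < y + 1)
    rw [slope_def_field] at h1
    have h2 := hu.toReal_le_toReal hy' (by linarith : y ≤ y + 1)
    simp only [hk, Pi.neg_apply, add_sub_cancel_left, div_one] at h1
    linarith
  · have hy' := interior_subset hy
    by_cases hz : u z = ⊥
    · rw [hz]; exact bot_le
    rw [← hu.coe_toReal hz, EReal.coe_le_coe_iff]
    rcases lt_trichotomy y z with h | rfl | h
    · have h1 := hconv.rightDeriv_le_slope_of_mem_interior hy hz h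
      rw [slope_def_field, le_div_iff₀ (by linarith)] at h1
      simp only [hk, Pi.neg_apply] at h1 ⊢
      linarith
    · simp
    · have h1 := (hconv.slope_le_leftDeriv_of_mem_interior hz hy h).trans
        (hconv.leftDeriv_le_rightDeriv_of_mem_interior hy)
      rw [slope_def_field, div_le_iff₀ (by linarith)] at h1
      simp only [hk, Pi.neg_apply] at h1 ⊢
      linarith

theorem ae_eq_Ioo_of_upward {A : Set ℝ}
    (h : ∀ q ∈ A, q ∈ Ioo (0 : ℝ) 1 → ∀ q' ∈ Ioo (0 : ℝ) 1, q < q' → q' ∈ A) :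
    ∃ p ∈ Icc (0 : ℝ) 1, A =ᵐ[volume.restrict (Ioo 0 1)] Ioo p 1 := by
  rcases (A ∩ Ioo 0 1).eq_empty_or_nonempty with he | hne
  · refine ⟨1, by simp, ?_⟩
    filter_upwards [ae_restrict_mem measurableSet_Ioo] with q hq
    refine propext ⟨fun hA => (notMem_empty q (he ▸ ⟨hA, hq⟩)).elim, fun h => ?_⟩
    exact absurd (show q ∈ Ioo (1 : ℝ) 1 from h) (by rw [Ioo_self]; exact notMem_empty q)
  have hbdd : BddBelow (A ∩ Ioo 0 1) := ⟨0, fun q hq => hq.2.1.le⟩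
  refine ⟨sInf (A ∩ Ioo 0 1), ⟨le_csInf hne fun q hq => hq.2.1.le, ?_⟩, ?_⟩
  · obtain ⟨q, hq⟩ := hne
    exact (csInf_le hbdd hq).trans hq.2.2.le
  filter_upwards [ae_restrict_mem measurableSet_Ioo,
    ae_restrict_of_ae (Measure.ae_ne volume (sInf (A ∩ Ioo 0 1)))] with q hq hqne
  refine propext ⟨fun hA => ⟨(csInf_le hbdd ⟨hA, hq⟩).lt_of_ne' hqne, hq.2⟩, fun hI => ?_⟩
  obtain ⟨r, hr, hrq⟩ := exists_lt_of_csInf_lt hne (show _ < q from hI.1)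
  exact h r hr.1 hr.2 q hq hrq

/-- The supergradient argument, with `X` capped at `c` so that `w - min X c` stays in the interior
of the domain of `u`, where slopes are bounded by the one at `w - c`. Near the endpoint of the
domain slopes may blow up. -/
theorem expE_utility_le_of_min [IsProbabilityMeasure P] {W : Ω → ℝ} (hu : IsUtility u)
    (hX : MemLp X ∞ P) (hW : MemLp W ∞ P)
    (h : ∀ p ∈ Icc (0 : ℝ) 1, tail P X p ≤ tail P W p) {w c : ℝ}
    (hc : w - c ∈ interior {y | u y ≠ ⊥}) :
    expE P (fun ω => u (w - W ω)) ≤ expE P (fun ω => u (w - min (X ω) c)) := by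
  obtain ⟨σ, hσ, hσ0, hsup⟩ := hu.exists_supergradient
  set a := quantile P X
  set b := quantile P W
  set μ : Measure ℝ := volume.restrict (Ioo 0 1) with hμ
  have hum : Measurable u := hu.2.1.measurable
  have hXm := hX.1.aemeasurable
  have hWm := hW.1.aemeasurable
  have hamono : MonotoneOn a (Ioo 0 1) := monotoneOn_quantile hXm
  have hint : ∀ q, w - min (a q) c ∈ interior {y | u y ≠ ⊥} := fun q =>
    hu.mem_interior_of_le hc (by linarith [min_le_right (a q) c])
  have hmin : ∀ q ∈ Ioo (0 : ℝ) 1, ∀ r ∈ Ioo (0 : ℝ) 1, q ≤ r →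
      w - min (a r) c ≤ w - min (a q) c := fun q hq r hr hqr =>
    sub_le_sub_left (min_le_min_right c (hamono hq hr hqr)) w
  obtain ⟨M, -, hM⟩ := exists_quantile_bound hX
  have ha : MemLp a ∞ μ := memLp_quantile hX
  have hb : MemLp b ∞ μ := memLp_quantile hW
  have hac : MemLp (fun q => min (a q) c) ∞ μ := ha.inf (memLp_const c)
  set D : ℝ → ℝ := fun q => σ (w - min (a q) c) with hDdef
  have hDmono : MonotoneOn D (Ioo 0 1) := fun q hq r hr hqr =>
    hσ (hint r) (hint q) (hmin q hq r hr hqr)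
  have hD0 : ∀ q, 0 ≤ D q := fun q => hσ0 _ (hint q)
  have hDle : ∀ q, D q ≤ σ (w - c) := fun q =>
    hσ hc (hint q) (by linarith [min_le_right (a q) c])
  have hD : MemLp D ∞ μ := by
    refine memLp_top_of_bound (aemeasurable_restrict_of_monotoneOn measurableSet_Ioo
      hDmono).aestronglyMeasurable (σ (w - c)) (Eventually.of_forall fun q => ?_)
    rw [Real.norm_eq_abs, abs_of_nonneg (hD0 q)]
    exact hDle q
  have hDi : Integrable D μ := hD.integrable le_top
  -- The superlevel sets of the increasing weight `D` are intervals `(p, 1)` up to null sets. The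
  -- integrals over them are tails, and capping `X` only lowers its own.
  have key : ∫ q, min (a q) c * D q ∂μ ≤ ∫ q, b q * D q ∂μ := by
    refine integral_mul_le_of_superlevel hDi (Eventually.of_forall hD0) hac hb fun t _ => ?_
    obtain ⟨p, hp, hA⟩ := ae_eq_Ioo_of_upward (A := {q | t < D q}) fun q hq hq1 r hr hqr =>
      lt_of_lt_of_le hq (hDmono hq1 hr hqr.le)
    have hr : μ.restrict (Ioo p 1) = volume.restrict (Ioo p 1) := by
      rw [hμ, Measure.restrict_restrict measurableSet_Ioo,
        inter_eq_left.2 (Ioo_subset_Ioo_left hp.1)]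
    rw [setIntegral_congr_set hA, setIntegral_congr_set hA]
    refine (integral_mono (hac.integrable le_top).integrableOn
      (ha.integrable le_top).integrableOn fun q => min_le_left _ _).trans ?_
    rw [hr]
    exact h p hp
  have hf : Integrable (fun q => (u (w - min (a q) c)).toReal) μ := by
    have hanti : AntitoneOn (fun q => (u (w - min (a q) c)).toReal) (Ioo 0 1) :=
      fun q hq r hr hqr => hu.toReal_le_toReal (interior_subset (hint r)) (hmin q hq r hr hqr)
    refine MemLp.integrable (q := ∞) le_top (memLp_top_of_bound
      (aemeasurable_restrict_of_antitoneOn measurableSet_Ioo hanti).aestronglyMeasurable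
      (max |(u (w - c)).toReal| |(u (w - min (-M) c)).toReal|) ?_)
    filter_upwards [ae_restrict_mem measurableSet_Ioo] with q hq
    refine abs_le_max_abs_abs ?_ ?_
    · exact hu.toReal_le_toReal (interior_subset hc) (by linarith [min_le_right (a q) c])
    · refine hu.toReal_le_toReal (interior_subset (hint q)) (sub_le_sub_left ?_ w)
      exact min_le_min_right c (abs_le.1 (hM q hq)).1
  have hacD : Integrable (fun q => min (a q) c * D q) μ :=
    (hD.mul (r := ∞) hac).integrable le_top
  have hbD : Integrable (fun q => b q * D q) μ := (hD.mul (r := ∞) hb).integrable le_top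
  have hdiff : Integrable (fun q => min (a q) c * D q - b q * D q) μ := hacD.sub hbD
  rw [← expE_comp_quantile hWm (f := fun t => u (w - t)) (hum.comp (by fun_prop)),
    ← expE_comp_quantile hXm (f := fun t => u (w - min t c)) (hum.comp (by fun_prop))]
  have h1 : ∀ q, u (w - min (a q) c) = ((u (w - min (a q) c)).toReal : EReal) := fun q =>
    (hu.coe_toReal (interior_subset (hint q))).symm
  calc expE μ (fun q => u (w - b q))
      ≤ expE μ (fun q => (((u (w - min (a q) c)).toReal +
          (min (a q) c * D q - b q * D q) : ℝ) : EReal)) := by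
        refine expE_mono (Eventually.of_forall fun q => (hsup _ (hint q) (w - b q)).trans_eq ?_)
        congr 1
        ring
    _ = ((∫ q, (u (w - min (a q) c)).toReal ∂μ +
          (∫ q, min (a q) c * D q ∂μ - ∫ q, b q * D q ∂μ) : ℝ) : EReal) := by
        rw [expE_coe (f := fun q => (u (w - min (a q) c)).toReal +
            (min (a q) c * D q - b q * D q)) (hf.add hdiff), integral_add hf hdiff,
          integral_sub hacD hbD]
    _ ≤ ((∫ q, (u (w - min (a q) c)).toReal ∂μ : ℝ) : EReal) := by
        rw [EReal.coe_le_coe_iff]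
        linarith
    _ = expE μ (fun q => u (w - min (a q) c)) := by
        rw [← expE_coe hf]
        exact congrArg _ (funext fun q => (h1 q).symm)

/-- Positions with smaller tail integrals have a larger expected utility. -/
theorem expE_utility_le_of_tail_le [IsProbabilityMeasure P] {W : Ω → ℝ} (hu : IsUtility u)
    (hX : MemLp X ∞ P) (hW : MemLp W ∞ P)
    (h : ∀ p ∈ Icc (0 : ℝ) 1, tail P X p ≤ tail P W p) (w : ℝ) :
    expE P (fun ω => u (w - W ω)) ≤ expE P (fun ω => u (w - X ω)) := by
  have hum : Measurable u := hu.2.1.measurable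
  obtain ⟨M, -, hM⟩ := exists_ae_abs_le hX
  by_cases hall : ∀ y, u y ≠ ⊥
  · refine (expE_utility_le_of_min hu hX hW h (w := w) (c := M)
      (hu.mem_interior (hall (w - M - 1)) (by linarith))).trans_eq (expE_congr ?_)
    filter_upwards [hM] with ω hω
    rw [min_eq_left (abs_le.1 hω).2]
  push Not at hall
  obtain ⟨y₀, hy₀⟩ := hall
  by_cases hbot : expE P (fun ω => u (w - W ω)) = ⊥
  · rw [hbot]; exact bot_le
  have hWne : ∀ᵐ ω ∂P, u (w - W ω) ≠ ⊥ :=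
    ne_bot_of_expE_ne_bot (hum.comp_aemeasurable (hW.1.aemeasurable.const_sub w)) hbot
  obtain ⟨ω₀, hω₀⟩ := hWne.exists
  set I := {y | u y ≠ ⊥}
  have hIne : I.Nonempty := ⟨_, hω₀⟩
  have hIbd : BddBelow I := ⟨y₀, fun y hy => le_of_not_gt fun hlt =>
    hu.ne_bot_of_le hy hlt.le hy₀⟩
  set α := sInf I
  have hWα : ∀ᵐ ω ∂P, W ω ≤ w - α := hWne.mono fun ω hω => by
    have : α ≤ w - W ω := csInf_le hIbd hω
    linarith
  have hXα : ∀ᵐ ω ∂P, X ω ≤ w - α := ae_le_of_tail_le hX fun p hp =>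
    (h p (Ioo_subset_Icc_self hp)).trans (tail_le_of_ae_le hW hWα (Ioo_subset_Icc_self hp))
  -- The caps increase to `w - α`, with `α` the left end of the domain of `u`. Since `X ≤ w - α`
  -- almost surely, `w - min X (c n)` decreases to `w - X`, and right-continuity of `u` gives the
  -- limit.
  set c : ℕ → ℝ := fun n => w - α - 1 / ((n : ℝ) + 1) with hc
  have hcmono : Monotone c := fun m n hmn => sub_le_sub_left (Nat.one_div_le_one_div hmn) _
  have hclim : Tendsto c atTop (𝓝 (w - α)) := by
    have := (tendsto_const_nhds (x := w - α)).sub (tendsto_one_div_add_atTop_nhds_zero_nat (𝕜 := ℝ))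
    rwa [sub_zero] at this
  have hcint : ∀ n, w - c n ∈ interior I := fun n => by
    have : α < w - c n := by
      have : (0 : ℝ) < 1 / ((n : ℝ) + 1) := by positivity
      simp only [hc]
      linarith
    obtain ⟨y, hy, hlt⟩ := exists_lt_of_csInf_lt hIne this
    exact hu.mem_interior hy hlt
  have hlim : Tendsto (fun n => expE P (fun ω => u (w - min (X ω) (c n)))) atTop
      (𝓝 (expE P (fun ω => u (w - X ω)))) := by
    refine tendsto_expE_of_antitone (M := (u (w - min (-M) (c 0))).toReal)
      (fun n => hum.comp_aemeasurable
        ((hX.1.aemeasurable.inf aemeasurable_const).const_sub w)) (fun n => ?_) ?_ ?_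
    · filter_upwards [hM] with ω hω
      have hI : u (w - min (-M) (c 0)) ≠ ⊥ :=
        hu.ne_bot_of_le (interior_subset (hcint 0)) (by linarith [min_le_right (-M) (c 0)])
      rw [hu.coe_toReal hI]
      exact hu.2.1 (sub_le_sub_left (min_le_min (abs_le.1 hω).1 (hcmono (Nat.zero_le n))) w)
    · exact Eventually.of_forall fun ω m n hmn =>
        hu.2.1 (sub_le_sub_left (min_le_min_left _ (hcmono hmn)) w)
    · filter_upwards [hXα] with ω hω
      have h1 : Tendsto (fun n => w - min (X ω) (c n)) atTop (𝓝 (w - X ω)) := by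
        have := (tendsto_const_nhds (x := X ω)).min hclim
        rw [min_eq_left hω] at this
        exact this.const_sub w
      exact (hu.2.2.2 (w - X ω)).tendsto.comp (tendsto_nhdsWithin_of_tendsto_nhds_of_eventually_within
        _ h1 (Eventually.of_forall fun n => sub_le_sub_left (min_le_left _ _) w))
  exact ge_of_tendsto' hlim fun n => expE_utility_le_of_min hu hX hW h (hcint n)

end Utility

theorem isUtility_coe {v : ℝ → ℝ} (hv : Monotone v) (hc : ConcaveOn ℝ univ v) :
    IsUtility (fun y => (v y : EReal)) := by
  refine ⟨fun y => EReal.coe_ne_top _, fun y z h => EReal.coe_le_coe_iff.2 (hv h),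
    fun y z t h0 h1 => ?_, fun y => ?_⟩
  · have := hc.2 (mem_univ y) (mem_univ z) h0.le (sub_nonneg.2 h1.le) (by ring)
    simp only [smul_eq_mul] at this
    dsimp only
    exact_mod_cast this
  · have hcont : Continuous v := by
      rw [← continuousOn_univ]
      exact hc.continuousOn isOpen_univ
    exact (continuous_coe_real_ereal.comp hcont).continuousWithinAt

theorem SSD_of_tail_le [IsProbabilityMeasure P] {W : Ω → ℝ} (hX : MemLp X ∞ P)
    (hW : MemLp W ∞ P) (h : ∀ p ∈ Icc (0 : ℝ) 1, tail P X p ≤ tail P W p) : SSD P X W :=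
  fun v hv hc => by
    simpa using expE_utility_le_of_tail_le (isUtility_coe hv hc) hX hW h 0

/-! ### Atomless probability spaces -/

theorem Atomless.exists_half (hP : Atomless P) [IsFiniteMeasure P] {A : Set Ω}
    (hA : MeasurableSet A) (hA0 : 0 < P.real A) :
    ∃ B, MeasurableSet B ∧ B ⊆ A ∧ 0 < P.real B ∧ P.real B ≤ P.real A / 2 := by
  obtain ⟨B, hB, hBA, h0, hlt⟩ := hP A hA (ENNReal.toReal_pos_iff.1 hA0).1
  have h0' : 0 < P.real B := ENNReal.toReal_pos h0.ne' (measure_ne_top _ _)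
  have hlt' : P.real B < P.real A :=
    (ENNReal.toReal_lt_toReal (measure_ne_top _ _) (measure_ne_top _ _)).2 hlt
  have hdiff : P.real (A \ B) = P.real A - P.real B := measureReal_sdiff hBA hB
  rcases le_total (P.real B) (P.real A / 2) with h | h
  · exact ⟨B, hB, hBA, h0', h⟩
  · exact ⟨A \ B, hA.diff hB, sdiff_subset, by linarith, by linarith⟩

theorem Atomless.exists_small (hP : Atomless P) [IsFiniteMeasure P] {A : Set Ω}
    (hA : MeasurableSet A) (hA0 : 0 < P.real A) {ε : ℝ} (hε : 0 < ε) :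
    ∃ B, MeasurableSet B ∧ B ⊆ A ∧ 0 < P.real B ∧ P.real B ≤ ε := by
  have h : ∀ n : ℕ, ∃ B, MeasurableSet B ∧ B ⊆ A ∧ 0 < P.real B ∧
      P.real B ≤ P.real A * (1 / 2) ^ n := by
    intro n
    induction n with
    | zero => exact ⟨A, hA, Subset.rfl, hA0, by simp⟩
    | succ n ih =>
      obtain ⟨B, hB, hBA, hB0, hBn⟩ := ih
      obtain ⟨C, hC, hCB, hC0, hCn⟩ := hP.exists_half hB hB0
      refine ⟨C, hC, hCB.trans hBA, hC0, hCn.trans ?_⟩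
      rw [pow_succ]
      linarith
  have hlim : Tendsto (fun n : ℕ => P.real A * (1 / 2) ^ n) atTop (𝓝 (P.real A * 0)) :=
    (tendsto_pow_atTop_nhds_zero_of_lt_one (by norm_num) (by norm_num)).const_mul _
  rw [mul_zero] at hlim
  obtain ⟨n, hn⟩ := (hlim.eventually (gt_mem_nhds hε)).exists
  obtain ⟨B, hB, hBA, hB0, hBn⟩ := h n
  exact ⟨B, hB, hBA, hB0, hBn.trans hn.le⟩

/-- Sierpiński's theorem: an atomless measure takes all intermediate values on subsets. -/
theorem Atomless.exists_subset_measureReal_eq (hP : Atomless P) [IsFiniteMeasure P] {A : Set Ω}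
    (hA : MeasurableSet A) {t : ℝ} (ht0 : 0 ≤ t) (ht : t ≤ P.real A) :
    ∃ B, MeasurableSet B ∧ B ⊆ A ∧ P.real B = t := by
  let G : Set (Set Ω) := {B | MeasurableSet B ∧ B ⊆ A ∧ P.real B ≤ t}
  -- Greedy exhaustion: each enlargement realizes at least half of the largest gain still allowed
  -- below `t`.
  have step : ∀ B : G, ∃ B' : G, (B : Set Ω) ⊆ B' ∧ ∀ C ∈ G, (B : Set Ω) ⊆ C →
      P.real C - P.real B ≤ 2 * (P.real (B' : Set Ω) - P.real (B : Set Ω)) := by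
    intro B
    set R : Set ℝ := P.real '' {C | C ∈ G ∧ (B : Set Ω) ⊆ C}
    have hmem : P.real (B : Set Ω) ∈ R := ⟨B, ⟨B.2, Subset.rfl⟩, rfl⟩
    have hbdd : BddAbove R := ⟨t, by rintro _ ⟨C, ⟨hC, -⟩, rfl⟩; exact hC.2.2⟩
    have hle : P.real (B : Set Ω) ≤ sSup R := le_csSup hbdd hmem
    have hR : ∀ C ∈ G, (B : Set Ω) ⊆ C → P.real C ≤ sSup R := fun C hC hBC =>
      le_csSup hbdd ⟨C, ⟨hC, hBC⟩, rfl⟩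
    rcases hle.eq_or_lt with heq | hlt
    · refine ⟨B, Subset.rfl, fun C hC hBC => ?_⟩
      linarith [hR C hC hBC]
    · obtain ⟨_, ⟨B', ⟨hB', hBB'⟩, rfl⟩, hlt'⟩ := exists_lt_of_lt_csSup ⟨_, hmem⟩
        (show (P.real (B : Set Ω) + sSup R) / 2 < sSup R by linarith)
      refine ⟨⟨B', hB'⟩, hBB', fun C hC hBC => ?_⟩
      dsimp only
      linarith [hR C hC hBC]
  choose next hsub hnext using step
  let F : ℕ → G := fun n => Nat.rec ⟨∅, MeasurableSet.empty, empty_subset _, by simpa using ht0⟩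
    (fun _ B => next B) n
  have hFmono : Monotone fun n : ℕ => (F n).1 :=
    by
    apply monotone_nat_of_le_succ
    intro n
    exact hsub (F n)
  set B : Set Ω := ⋃ n, (F n).1
  have hB : MeasurableSet B := MeasurableSet.iUnion fun n => (F n).2.1
  have hBA : B ⊆ A := iUnion_subset fun n => (F n).2.2.1
  have hlim : Tendsto (fun n => P.real (F n).1) atTop (𝓝 (P.real B)) :=
    (ENNReal.tendsto_toReal (measure_ne_top _ _)).comp (tendsto_measure_iUnion_atTop hFmono)
  have hBt : P.real B ≤ t := le_of_tendsto' hlim fun n => (F n).2.2.2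
  refine ⟨B, hB, hBA, le_antisymm hBt ?_⟩
  by_contra! hlt
  have hd : P.real (A \ B) = P.real A - P.real B := measureReal_sdiff hBA hB
  -- If the union `B` falls short of `t`, a small `C` could have been added at every stage. Each
  -- increment is then at least half of a gain bounded below by `P(C)`, which contradicts
  -- convergence.
  obtain ⟨C, hC, hCA, hC0, hCt⟩ := hP.exists_small (hA.diff hB) (by linarith)
    (sub_pos.2 hlt)
  have hdisj : Disjoint B C := disjoint_sdiff_right.mono_right hCA
  have hBC : P.real (B ∪ C) = P.real B + P.real C := measureReal_union hdisj hC
  have hG : B ∪ C ∈ G := ⟨hB.union hC, union_subset hBA (hCA.trans sdiff_subset), by linarith⟩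
  have h1 : ∀ n, P.real (B ∪ C) - P.real (F n).1 ≤
      2 * (P.real (F (n + 1)).1 - P.real (F n).1) := fun n =>
    hnext (F n) _ hG
      ((subset_iUnion (fun n : ℕ => (F n).1) n).trans subset_union_left)
  have h2 := le_of_tendsto_of_tendsto' (hlim.const_sub _)
    (((hlim.comp (tendsto_add_atTop_nat 1)).sub hlim).const_mul 2) h1
  linarith

/-- By minimality of the quantile `c`, each `{X ≤ c - 1/(n+1)}` has probability below `q`, and these
sets increase to `{X < c}`. -/
theorem measure_lt_quantile_le [IsProbabilityMeasure P] (hX : AEMeasurable X P) {q : ℝ}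
    (hq : q ∈ Ioo (0 : ℝ) 1) : P {ω | X ω < quantile P X q} ≤ ENNReal.ofReal q := by
  set c := quantile P X q
  have hmono : Monotone fun n : ℕ => {ω | X ω ≤ c - 1 / ((n : ℝ) + 1)} :=
    fun m n hmn ω (hω : X ω ≤ _) => hω.trans (sub_le_sub_left (Nat.one_div_le_one_div hmn) _)
  have hU : {ω | X ω < c} = ⋃ n : ℕ, {ω | X ω ≤ c - 1 / ((n : ℝ) + 1)} := by
    ext ω
    simp only [mem_iUnion]
    constructor
    · intro h
      obtain ⟨n, hn⟩ := exists_nat_one_div_lt (sub_pos.2 (show X ω < c from h))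
      exact ⟨n, show X ω ≤ c - 1 / ((n : ℝ) + 1) by linarith⟩
    · rintro ⟨n, hn⟩
      have h1 : X ω ≤ c - 1 / ((n : ℝ) + 1) := hn
      have h2 : (0 : ℝ) < 1 / ((n : ℝ) + 1) := by positivity
      show X ω < c
      linarith
  rw [hU]
  refine le_of_tendsto' (tendsto_measure_iUnion_atTop hmono) fun n => ?_
  have h2 : (0 : ℝ) < 1 / ((n : ℝ) + 1) := by positivity
  refine le_of_not_ge fun h => ?_
  have := (quantile_le_iff hX hq _).2 h
  linarith

/-- An initial segment for `Y` of prescribed probability. -/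
theorem Atomless.exists_initial_subset (hP : Atomless P) [IsFiniteMeasure P] (hY : Measurable Y)
    {D : Set Ω} (hD : MeasurableSet D) {t : ℝ} (ht0 : 0 ≤ t) (ht : t ≤ P.real D) :
    ∃ E, MeasurableSet E ∧ E ⊆ D ∧ P.real E = t ∧ ∀ ω ∈ E, ∀ ω' ∈ D \ E, Y ω ≤ Y ω' := by
  rcases ht0.eq_or_lt with rfl | ht0
  · exact ⟨∅, MeasurableSet.empty, empty_subset _, by simp, by simp⟩
  rcases ht.eq_or_lt with rfl | ht
  · exact ⟨D, hD, Subset.rfl, rfl, by simp⟩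
  have hD0 : 0 < P.real D := ht0.trans ht
  have hPD : P D ≠ 0 := (ENNReal.toReal_pos_iff.1 hD0).1.ne'
  have hprob := ProbabilityTheory.cond_isProbabilityMeasure hPD
  have hcond : ∀ B, MeasurableSet B →
      (ProbabilityTheory.cond P D).real B = (P.real D)⁻¹ * P.real (D ∩ B) := fun B _ => by
    rw [measureReal_def, ProbabilityTheory.cond_apply hD, ENNReal.toReal_mul,
      ENNReal.toReal_inv]
    rfl
  have hq : t / P.real D ∈ Ioo (0 : ℝ) 1 := ⟨by positivity, (div_lt_one hD0).2 ht⟩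
  -- The threshold is a quantile of `Y` conditionally on `D`: `{Y < c}` is too small or exact, `{Y ≤
  -- c}` too large or exact. Sierpiński's theorem then splits the level set `{Y = c}`.
  set c := quantile (ProbabilityTheory.cond P D) Y (t / P.real D)
  have hlt : MeasurableSet {ω | Y ω < c} := measurableSet_lt hY measurable_const
  have hle : MeasurableSet {ω | Y ω ≤ c} := measurableSet_le hY measurable_const
  have h1 : P.real (D ∩ {ω | Y ω < c}) ≤ t := by
    have h := measure_lt_quantile_le (P := ProbabilityTheory.cond P D) hY.aemeasurable hq
    rw [← ofReal_measureReal, ENNReal.ofReal_le_ofReal_iff hq.1.le, hcond _ hlt,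
      inv_mul_eq_div] at h
    exact (div_le_div_iff_of_pos_right hD0).1 h
  have h2 : t ≤ P.real (D ∩ {ω | Y ω ≤ c}) := by
    have h := (quantile_le_iff (P := ProbabilityTheory.cond P D) hY.aemeasurable hq c).1 le_rfl
    rw [← ofReal_measureReal, ENNReal.ofReal_le_ofReal_iff measureReal_nonneg, hcond _ hle,
      inv_mul_eq_div] at h
    exact (div_le_div_iff_of_pos_right hD0).1 h
  have hsub : D ∩ {ω | Y ω < c} ⊆ D ∩ {ω | Y ω ≤ c} :=
    inter_subset_inter_right _ fun ω (h : Y ω < c) => h.le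
  have h3 : P.real ((D ∩ {ω | Y ω ≤ c}) \ (D ∩ {ω | Y ω < c})) =
      P.real (D ∩ {ω | Y ω ≤ c}) - P.real (D ∩ {ω | Y ω < c}) :=
    measureReal_sdiff hsub (hD.inter hlt)
  obtain ⟨F, hF, hFsub, hFt⟩ := hP.exists_subset_measureReal_eq
    ((hD.inter hle).diff (hD.inter hlt))
    (t := t - P.real (D ∩ {ω | Y ω < c})) (by linarith) (by linarith)
  refine ⟨(D ∩ {ω | Y ω < c}) ∪ F, (hD.inter hlt).union hF,
    union_subset inter_subset_left fun ω hω => (hFsub hω).1.1, ?_, ?_⟩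
  · rw [measureReal_union (disjoint_sdiff_right.mono_right hFsub) hF]
    linarith
  · intro ω hω ω' hω'
    have hω1 : Y ω ≤ c := by
      rcases hω with hω | hω
      · exact le_of_lt hω.2
      · exact (hFsub hω).1.2
    have hω2 : c ≤ Y ω' := le_of_not_gt fun h => hω'.2 (Or.inl ⟨hω'.1, h⟩)
    exact hω1.trans hω2

/-! ### Uniform random variables -/

/-- Measurable initial segments for the preorder induced by `Y`. -/
def InitialSeg (Y : Ω → ℝ) : Set (Set Ω) :=
  {A | MeasurableSet A ∧ ∀ ω ∈ A, ∀ ω' ∉ A, Y ω ≤ Y ω'}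

theorem Atomless.exists_mid (hP : Atomless P) [IsFiniteMeasure P] (hY : Measurable Y)
    {A C : Set Ω} (hA : A ∈ InitialSeg Y) (hC : C ∈ InitialSeg Y) (hAC : A ⊆ C) :
    ∃ B ∈ InitialSeg Y, A ⊆ B ∧ B ⊆ C ∧ P.real B = (P.real A + P.real C) / 2 := by
  have hd : P.real (C \ A) = P.real C - P.real A := measureReal_sdiff hAC hA.1
  have h0 : P.real A ≤ P.real C := measureReal_mono hAC
  obtain ⟨E, hE, hED, hEt, hEi⟩ := hP.exists_initial_subset hY (hC.1.diff hA.1)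
    (t := (P.real C - P.real A) / 2) (by linarith) (by linarith)
  refine ⟨A ∪ E, ⟨hA.1.union hE, fun ω hω ω' hω' => ?_⟩, subset_union_left,
    union_subset hAC (hED.trans sdiff_subset), ?_⟩
  · have hω'A : ω' ∉ A := fun h => hω' (Or.inl h)
    have hω'E : ω' ∉ E := fun h => hω' (Or.inr h)
    rcases hω with hω | hω
    · exact hA.2 ω hω ω' hω'A
    · by_cases hC' : ω' ∈ C
      · exact hEi ω hω ω' ⟨⟨hC', hω'A⟩, hω'E⟩
      · exact hC.2 ω (hED hω).1 ω' hC'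
  · rw [measureReal_union (disjoint_sdiff_right.mono_right hED) hE]
    linarith

/-- Dyadic families of initial segments. -/
theorem Atomless.exists_dyadic (hP : Atomless P) [IsProbabilityMeasure P] (hY : Measurable Y) :
    ∃ A : ℕ → ℕ → Set Ω, (∀ n k, A n k ∈ InitialSeg Y) ∧ (∀ n, Monotone (A n)) ∧
      (∀ n k, A (n + 1) (2 * k) = A n k) ∧
      ∀ n k, P.real (A n k) = min ((k : ℝ) / 2 ^ n) 1 := by
  -- The cap at 1 lets the index run over all of `ℕ`.
  let good : ℕ → Set (ℕ → Set Ω) := fun n => {f | (∀ k, f k ∈ InitialSeg Y) ∧ Monotone f ∧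
    ∀ k : ℕ, P.real (f k) = min ((k : ℝ) / 2 ^ n) 1}
  have step : ∀ (n : ℕ) (f : {f // f ∈ good n}), ∃ f' : {f // f ∈ good (n + 1)},
      ∀ k, f'.1 (2 * k) = f.1 k := by
    rintro n ⟨f, hfI, hfm, hfP⟩
    choose B hBI hB1 hB2 hBP using fun k =>
      hP.exists_mid hY (hfI k) (hfI (k + 1)) (hfm (Nat.le_succ k))
    have hpow : (0 : ℝ) < 2 ^ n := by positivity
    -- Even indices keep the old segments; an odd index receives a segment midway in probability
    -- between its neighbours.
    refine ⟨⟨fun j => if Even j then f (j / 2) else B (j / 2), fun k => ?_, ?_, fun k => ?_⟩,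
      fun k => ?_⟩
    · dsimp only
      split_ifs
      exacts [hfI _, hBI _]
    · refine monotone_nat_of_le_succ fun j => ?_
      obtain ⟨m, rfl | rfl⟩ := Nat.even_or_odd' j
      · rw [if_pos (even_two_mul m), if_neg (by simp),
          show (2 * m + 1) / 2 = m by omega, show 2 * m / 2 = m by omega]
        exact hB1 m
      · have he : Even (2 * m + 1 + 1) := Nat.even_add_one.2 (by simp)
        rw [if_pos he, if_neg (by simp),
          show (2 * m + 1) / 2 = m by omega, show (2 * m + 1 + 1) / 2 = m + 1 by omega]
        exact hB2 m
    · dsimp only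
      obtain ⟨m, rfl | rfl⟩ := Nat.even_or_odd' k
      · rw [if_pos (even_two_mul m), show 2 * m / 2 = m by omega, hfP, pow_succ]
        congr 1
        push_cast
        field_simp
      · rw [if_neg (by simp), show (2 * m + 1) / 2 = m by omega, hBP, hfP, hfP,
          pow_succ]
        push_cast
        rcases Nat.lt_or_ge m (2 ^ n) with h | h
        · have h1 : (m : ℝ) + 1 ≤ 2 ^ n := by exact_mod_cast h
          rw [min_eq_left ((div_le_one hpow).2 (by linarith)), min_eq_left ((div_le_one hpow).2 h1),
            min_eq_left ((div_le_one (by positivity)).2 (by linarith))]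
          field_simp
          ring
        · have h1 : (2 : ℝ) ^ n ≤ m := by exact_mod_cast h
          rw [min_eq_right ((one_le_div hpow).2 h1), min_eq_right ((one_le_div hpow).2 (by linarith)),
            min_eq_right ((one_le_div (by positivity)).2 (by linarith))]
          norm_num
    · dsimp only
      rw [if_pos (even_two_mul k), show 2 * k / 2 = k by omega]
  choose next hnext using step
  have base : (fun k : ℕ => if k = 0 then (∅ : Set Ω) else univ) ∈ good 0 := by
    refine ⟨fun k => ?_, monotone_nat_of_le_succ fun k => ?_, fun k => ?_⟩
    · dsimp only
      split_ifs
      exacts [⟨MeasurableSet.empty, by simp⟩, ⟨MeasurableSet.univ, by simp⟩]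
    · rw [if_neg (Nat.succ_ne_zero k)]
      exact subset_univ _
    · rcases Nat.eq_zero_or_pos k with rfl | hk
      · simp
      · have : (1 : ℝ) ≤ k := by exact_mod_cast hk
        simp [hk.ne', this]
  let F : ∀ n, {f // f ∈ good n} := fun n => Nat.rec ⟨_, base⟩ (fun n f => next n f) n
  exact ⟨fun n => (F n).1, fun n => (F n).2.1, fun n => (F n).2.2.1, fun n => hnext n (F n),
    fun n => (F n).2.2.2⟩

/-- On an atomless probability space every random variable is an increasing transform of
a uniform random variable. -/
theorem Atomless.exists_uniform (hP : Atomless P) [IsProbabilityMeasure P] (hY : Measurable Y) :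
    ∃ U : Ω → ℝ, Measurable U ∧ P.map U = volume.restrict (Ioo 0 1) ∧
      ∀ ω ω', U ω < U ω' → Y ω ≤ Y ω' := by
  classical
  obtain ⟨A, hAI, hAm, hA2, hAP⟩ := hP.exists_dyadic hY
  have hlevel : ∀ n j k, A (n + j) (2 ^ j * k) = A n k := by
    intro n j
    induction j with
    | zero => simp
    | succ j ih =>
      intro k
      rw [← add_assoc, pow_succ', mul_assoc, hA2, ih]
  have hsub : ∀ m k n l : ℕ, (k : ℝ) / 2 ^ m ≤ l / 2 ^ n → A m k ⊆ A n l := by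
    intro m k n l h
    rw [← hlevel m n k, ← hlevel n m l, add_comm n m]
    refine hAm _ ?_
    rw [div_le_div_iff₀ (by positivity) (by positivity)] at h
    have h' : k * 2 ^ n ≤ l * 2 ^ m := by exact_mod_cast h
    linarith
  -- `U` will be the infimum of the dyadic levels of the segments containing `ω`. A segment missing
  -- `ω` contributes the neutral value 1.
  let c : ℕ × ℕ → Ω → ℝ := fun i ω => if ω ∈ A i.1 i.2 then (i.2 : ℝ) / 2 ^ i.1 else 1
  have hc0 : ∀ i ω, 0 ≤ c i ω := fun i ω => by
    simp only [c]
    split_ifs <;> positivity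
  have hcm : ∀ i, Measurable (c i) := fun i =>
    Measurable.ite (hAI _ _).1 measurable_const measurable_const
  have hbdd : ∀ ω, BddBelow (range fun i => c i ω) := fun ω =>
    ⟨0, by rintro _ ⟨i, rfl⟩; exact hc0 i ω⟩
  let U : Ω → ℝ := fun ω => ⨅ i, c i ω
  have hUm : Measurable U := Measurable.iInf hcm
  have hUle : ∀ m k ω, ω ∈ A m k → U ω ≤ k / 2 ^ m := fun m k ω h => by
    have := ciInf_le (hbdd ω) (m, k)
    simpa only [c, if_pos h] using this
  have hU0 : ∀ ω, 0 ≤ U ω := fun ω => le_ciInf fun i => hc0 i ω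
  have hU1 : ∀ ω, U ω ≤ 1 := fun ω => (ciInf_le (hbdd ω) (0, 0)).trans (by
    simp only [c]
    split_ifs <;> simp)
  have hUlt : ∀ ω r, r ≤ 1 → U ω < r → ∃ m k, ω ∈ A m k ∧ (k : ℝ) / 2 ^ m < r := by
    intro ω r hr h
    obtain ⟨i, hi⟩ := exists_lt_of_ciInf_lt h
    by_cases hω : ω ∈ A i.1 i.2
    · exact ⟨i.1, i.2, hω, by simpa only [c, if_pos hω] using hi⟩
    · simp only [c, if_neg hω] at hi
      linarith
  have hcdf : ∀ r ∈ Ico (0 : ℝ) 1, P.real {ω | U ω ≤ r} = r := by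
    intro r hr
    have hfl : ∀ n : ℕ, (⌊r * 2 ^ n⌋₊ : ℝ) / 2 ^ n ≤ r := fun n =>
      (div_le_iff₀ (by positivity)).2 (Nat.floor_le (mul_nonneg hr.1 (by positivity)))
    have hfl' : ∀ n : ℕ, r < ((⌊r * 2 ^ n⌋₊ + 1 : ℕ) : ℝ) / 2 ^ n := fun n => by
      rw [lt_div_iff₀ (by positivity)]
      push_cast
      exact Nat.lt_floor_add_one _
    have hpow : ∀ n : ℕ, ((⌊r * 2 ^ n⌋₊ + 1 : ℕ) : ℝ) / 2 ^ n =
        (⌊r * 2 ^ n⌋₊ : ℝ) / 2 ^ n + (1 / 2) ^ n := fun n => by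
      push_cast
      rw [add_div, div_pow, one_pow]
    have hlow : ∀ n : ℕ, r - (1 / 2) ^ n ≤ P.real {ω | U ω ≤ r} := by
      intro n
      have h1 : P.real (A n ⌊r * 2 ^ n⌋₊) ≤ P.real {ω | U ω ≤ r} :=
        measureReal_mono fun ω hω => (hUle _ _ ω hω).trans (hfl n)
      rw [hAP, min_eq_left ((hfl n).trans hr.2.le)] at h1
      linarith [hfl' n, hpow n]
    have hup : ∀ n : ℕ, P.real {ω | U ω ≤ r} ≤ r + (1 / 2) ^ n := by
      intro n
      have h1 : P.real {ω | U ω ≤ r} ≤ P.real (A n (⌊r * 2 ^ n⌋₊ + 1)) := by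
        refine measureReal_mono fun ω (hω : U ω ≤ r) => ?_
        obtain ⟨m, l, hml, hlt⟩ := hUlt ω (min (((⌊r * 2 ^ n⌋₊ + 1 : ℕ) : ℝ) / 2 ^ n) 1)
          (min_le_right _ _) (hω.trans_lt (lt_min (hfl' n) hr.2))
        exact hsub m l n _ (hlt.le.trans (min_le_left _ _)) hml
      rw [hAP] at h1
      linarith [hfl n, hpow n, min_le_left (((⌊r * 2 ^ n⌋₊ + 1 : ℕ) : ℝ) / 2 ^ n) 1]
    have hlim : Tendsto (fun n : ℕ => ((1 : ℝ) / 2) ^ n) atTop (𝓝 0) :=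
      tendsto_pow_atTop_nhds_zero_of_lt_one (by norm_num) (by norm_num)
    refine le_antisymm ?_ ?_
    · simpa using ge_of_tendsto' (hlim.const_add r) hup
    · simpa using le_of_tendsto' (hlim.const_sub r) hlow
  refine ⟨U, hUm, ?_, fun ω ω' h => ?_⟩
  · have := Measure.isProbabilityMeasure_map (μ := P) hUm.aemeasurable
    refine Measure.ext_of_Iic _ _ fun t => ?_
    rw [Measure.map_apply hUm measurableSet_Iic, Measure.restrict_apply measurableSet_Iic]
    rcases lt_or_ge t 0 with ht | ht
    · rw [show U ⁻¹' Iic t = ∅ from eq_empty_of_forall_notMem fun ω hω =>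
          absurd (ht.trans_le (hU0 ω)) (not_lt.2 hω),
        show Iic t ∩ Ioo 0 1 = ∅ from eq_empty_of_forall_notMem fun q hq =>
          absurd (hq.2.1.trans_le hq.1) (not_lt.2 ht.le)]
      simp
    rcases lt_or_ge t 1 with ht1 | ht1
    · rw [show Iic t ∩ Ioo 0 1 = Ioc 0 t from Set.ext fun q =>
          ⟨fun h => ⟨h.2.1, h.1⟩, fun h => ⟨h.2, h.1, h.2.trans_lt ht1⟩⟩,
        Real.volume_Ioc, sub_zero, show U ⁻¹' Iic t = {ω | U ω ≤ t} from rfl,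
        ← ofReal_measureReal, hcdf t ⟨ht, ht1⟩]
    · rw [show U ⁻¹' Iic t = univ from eq_univ_of_forall fun ω => (hU1 ω).trans ht1,
        inter_eq_right.2 fun q hq => hq.2.le.trans ht1]
      simp
  -- Some segment of level below `U ω'` contains `ω`; it cannot contain `ω'`, so the defining
  -- property of segments orders `Y`.
  · obtain ⟨m, k, hω, hk⟩ := hUlt ω (U ω') (hU1 ω') h
    exact (hAI m k).2 ω hω ω' fun h' => absurd (hUle m k ω' h') (not_le.2 hk)

/-! ### Profiles -/

variable {g : ℝ → EReal} {γ : ℝ → ℝ}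

/-- Bounded Expected Shortfall profiles with linear growth at `0`, as real functions. -/
structure RealProfile (γ : ℝ → ℝ) : Prop where
  mono : MonotoneOn γ (Icc 0 1)
  growth : ∃ C : ℝ, ∀ p ∈ Icc (0 : ℝ) 1, γ p ≤ γ 0 + C * p
  concave : ConcaveOn ℝ (Ioo 0 1) (fun p => (1 - p) * γ p)
  left : ∀ p ∈ Ioc (0 : ℝ) 1, ContinuousWithinAt γ (Iio p) p
  right : ContinuousWithinAt γ (Ioi 0) 0

theorem IsESProfile.coe_toReal (hg : IsESProfile g)
    (hgb : ∃ C : ℝ, ∀ p ∈ Icc (0 : ℝ) 1, g p ≤ g 0 + ((C * p : ℝ) : EReal)) {p : ℝ}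
    (hp : p ∈ Icc (0 : ℝ) 1) : ((g p).toReal : EReal) = g p := by
  refine EReal.coe_toReal ?_ (hg.1.1.2.1 p hp)
  obtain ⟨C, hC⟩ := hgb
  have h0 : g 0 ≠ ⊤ := hg.1.2.1 0 (by simp)
  exact ne_top_of_le_ne_top (EReal.add_ne_top h0 (EReal.coe_ne_top _)) (hC p hp)

theorem IsESProfile.realProfile (hg : IsESProfile g)
    (hgb : ∃ C : ℝ, ∀ p ∈ Icc (0 : ℝ) 1, g p ≤ g 0 + ((C * p : ℝ) : EReal)) :
    RealProfile (fun p => (g p).toReal) := by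
  have hcoe : ∀ p ∈ Icc (0 : ℝ) 1, ((g p).toReal : EReal) = g p := fun p hp =>
    hg.coe_toReal hgb hp
  have hcont : ∀ p ∈ Icc (0 : ℝ) 1, ∀ s : Set ℝ, ContinuousWithinAt g s p →
      ContinuousWithinAt (fun p => (g p).toReal) s p := fun p hp s h =>
    (EReal.tendsto_toReal (by rw [← hcoe p hp]; exact EReal.coe_ne_top _)
      (by rw [← hcoe p hp]; exact EReal.coe_ne_bot _)).comp h
  refine ⟨fun p hp q hq hpq => ?_, ?_, ?_, fun p hp => ?_, ?_⟩
  · rw [← EReal.coe_le_coe_iff, hcoe p hp, hcoe q hq]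
    exact hg.1.1.1 hp hq hpq
  · obtain ⟨C, hC⟩ := hgb
    refine ⟨C, fun p hp => ?_⟩
    have := hC p hp
    rw [← hcoe p hp, ← hcoe 0 (by simp)] at this
    exact_mod_cast this
  · have := hg.2.1
    simpa only [hFun, EReal.toReal_mul, EReal.toReal_coe] using this
  · exact hcont p (Ioc_subset_Icc_self hp) _ (hg.1.2.2.1 p hp)
  · exact hcont 0 (by simp) _ hg.1.2.2.2

theorem RealProfile.continuousOn (hγ : RealProfile γ) :
    ContinuousOn (fun p => (1 - p) * γ p) (Icc 0 1) := by
  intro p hp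
  rcases hp.1.eq_or_lt with rfl | h0
  · have h : ContinuousWithinAt γ (Ici 0) 0 := continuousWithinAt_Ioi_iff_Ici.1 hγ.right
    exact ((continuous_const.sub continuous_id).continuousWithinAt).mul (h.mono Icc_subset_Ici_self)
  rcases hp.2.eq_or_lt with rfl | h1
  · have h : ContinuousWithinAt γ (Iic 1) 1 :=
      continuousWithinAt_Iio_iff_Iic.1 (hγ.left 1 (by simp))
    exact ((continuous_const.sub continuous_id).continuousWithinAt).mul (h.mono Icc_subset_Iic_self)
  · exact ((hγ.concave.continuousOn isOpen_Ioo).continuousAt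
      (isOpen_Ioo.mem_nhds ⟨h0, h1⟩)).continuousWithinAt

/-- Take the right derivative of the convex `k = -(1 - p) γ(p)`. It is at most the slope of the
chord to 1, which is `γ p ≤ γ 1`. It is at least the slope of the chord from 0, which the growth
condition bounds below. Being bounded, it is integrable and recovers `k`. -/
theorem RealProfile.exists_density (hγ : RealProfile γ) :
    ∃ φ : ℝ → ℝ, MonotoneOn φ (Ioo 0 1) ∧ (∃ M, ∀ p ∈ Ioo (0 : ℝ) 1, |φ p| ≤ M) ∧
      ∀ p ∈ Icc (0 : ℝ) 1, ∫ q in Ioo p 1, φ q = (1 - p) * γ p := by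
  set k : ℝ → ℝ := fun p => -((1 - p) * γ p) with hk
  have hkconv : ConvexOn ℝ (Ioo 0 1) k := hγ.concave.neg
  have hkcont : ContinuousOn k (Icc 0 1) := hγ.continuousOn.neg
  set φ : ℝ → ℝ := fun p => derivWithin k (Ioi p) p
  have hmono : MonotoneOn φ (Ioo 0 1) := by
    have := hkconv.monotoneOn_rightDeriv
    rwa [interior_Ioo] at this
  have hup : ∀ p ∈ Ioo (0 : ℝ) 1, φ p ≤ γ 1 := by
    intro p hp
    have hlim : Tendsto (fun y => (k y - k p) / (y - p)) (𝓝[<] 1) (𝓝 ((k 1 - k p) / (1 - p))) := by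
      have h1 : Tendsto k (𝓝[<] 1) (𝓝 (k 1)) :=
        ((hkcont 1 (by simp)).mono_left (nhdsWithin_le_of_mem
          (mem_of_superset (Ioo_mem_nhdsLT zero_lt_one) Ioo_subset_Icc_self)))
      have h2 : Tendsto (fun y : ℝ => y) (𝓝[<] 1) (𝓝 1) := nhdsWithin_le_nhds
      exact (h1.sub_const _).div (h2.sub_const _) (by linarith [hp.2])
    have h1 : φ p ≤ (k 1 - k p) / (1 - p) := by
      refine ge_of_tendsto hlim ?_
      filter_upwards [Ioo_mem_nhdsLT hp.2] with y hy
      rw [← slope_def_field]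
      exact hkconv.rightDeriv_le_slope_of_mem_interior (by rwa [interior_Ioo])
        ⟨hp.1.trans hy.1, hy.2⟩ hy.1
    have h2 : (k 1 - k p) / (1 - p) = γ p := by
      have : (1 : ℝ) - p ≠ 0 := by linarith [hp.2]
      simp only [hk]
      field_simp
      ring
    rw [h2] at h1
    exact h1.trans (hγ.mono (Ioo_subset_Icc_self hp) (by simp) hp.2.le)
  obtain ⟨C, hC⟩ := hγ.growth
  have hlow : ∀ p ∈ Ioo (0 : ℝ) 1, γ 0 - |C| ≤ φ p := by
    intro p hp
    have hlim : Tendsto (fun y => (k p - k y) / (p - y)) (𝓝[>] 0) (𝓝 ((k p - k 0) / (p - 0))) := by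
      have h1 : Tendsto k (𝓝[>] 0) (𝓝 (k 0)) :=
        ((hkcont 0 (by simp)).mono_left (nhdsWithin_le_of_mem
          (mem_of_superset (Ioo_mem_nhdsGT zero_lt_one) Ioo_subset_Icc_self)))
      have h2 : Tendsto (fun y : ℝ => y) (𝓝[>] 0) (𝓝 0) := nhdsWithin_le_nhds
      exact (h1.const_sub _).div (h2.const_sub _) (by linarith [hp.1])
    have h1 : (k p - k 0) / (p - 0) ≤ φ p := by
      refine le_of_tendsto hlim ?_
      filter_upwards [Ioo_mem_nhdsGT hp.1] with y hy
      rw [← slope_def_field]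
      have hp' : p ∈ interior (Ioo (0 : ℝ) 1) := by rwa [interior_Ioo]
      exact (hkconv.slope_le_leftDeriv_of_mem_interior ⟨hy.1, hy.2.trans hp.2⟩ hp' hy.2).trans
        (hkconv.leftDeriv_le_rightDeriv_of_mem_interior hp')
    refine le_trans ?_ h1
    rw [sub_zero, le_div_iff₀ hp.1]
    have h2 := mul_le_mul_of_nonneg_left (hC p (Ioo_subset_Icc_self hp))
      (by linarith [hp.2] : 0 ≤ 1 - p)
    have h3 : C * p * (1 - p) ≤ |C| * p := by
      have h4 : C * p ≤ |C| * p := mul_le_mul_of_nonneg_right (le_abs_self C) hp.1.le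
      have h5 : 0 ≤ |C| * p := mul_nonneg (abs_nonneg C) hp.1.le
      nlinarith [hp.1, hp.2, mul_le_mul_of_nonneg_right h4 (by linarith [hp.2] : 0 ≤ 1 - p)]
    simp only [hk]
    linarith
  have hbound : ∀ p ∈ Ioo (0 : ℝ) 1, |φ p| ≤ max (abs (γ 0 - |C|)) |γ 1| := fun p hp =>
    abs_le_max_abs_abs (hlow p hp) (hup p hp)
  have hint : IntegrableOn φ (Ioo 0 1) := by
    refine MemLp.integrable (q := ∞) le_top (memLp_top_of_bound
      (aemeasurable_restrict_of_monotoneOn measurableSet_Ioo hmono).aestronglyMeasurable (max (abs (γ 0 - |C|)) |γ 1|) ?_)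
    filter_upwards [ae_restrict_mem measurableSet_Ioo] with p hp using hbound p hp
  refine ⟨φ, hmono, ⟨_, hbound⟩, fun p hp => ?_⟩
  have h := intervalIntegral.integral_eq_sub_of_hasDeriv_right_of_le (f := k) (f' := φ) hp.2
    (hkcont.mono (Icc_subset_Icc_left hp.1)) (fun q hq =>
      hkconv.hasDerivWithinAt_rightDeriv_of_mem_interior
        (by rw [interior_Ioo]; exact ⟨hp.1.trans_lt hq.1, hq.2⟩))
    ((intervalIntegrable_iff_integrableOn_Ioo_of_le hp.2).2
      (hint.mono_set (Ioo_subset_Ioo_left hp.1)))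
  rw [intervalIntegral.integral_of_le hp.2, integral_Ioc_eq_integral_Ioo] at h
  rw [h]
  simp [hk]

/-- `Z = φ(U)` is larger on `{U > p}` than off it, so `setIntegral_eq_tail` computes its tails
without identifying its quantile function with `φ`. Both `Z` and `Y` increase with `U`, hence they
are comonotonic. -/
theorem RealProfile.exists_comonotonic (hγ : RealProfile γ) (hP : Atomless P)
    [IsProbabilityMeasure P] (hY : Measurable Y) :
    ∃ Z : Ω → ℝ, MemLp Z ∞ P ∧ (∀ p ∈ Icc (0 : ℝ) 1, tail P Z p = (1 - p) * γ p) ∧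
      Comonotonic P Z Y := by
  obtain ⟨φ, hmono, ⟨M, hM⟩, hφ⟩ := hγ.exists_density
  obtain ⟨U, hU, hlaw, hUY⟩ := hP.exists_uniform hY
  have hφm : AEMeasurable φ (P.map U) := by
    rw [hlaw]
    exact aemeasurable_restrict_of_monotoneOn measurableSet_Ioo hmono
  have hS : {ω | U ω ∈ Ioo (0 : ℝ) 1} ∈ ae P := by
    have : ∀ᵐ q ∂(P.map U), q ∈ Ioo (0 : ℝ) 1 := by
      rw [hlaw]
      exact ae_restrict_mem measurableSet_Ioo
    exact (ae_map_iff hU.aemeasurable measurableSet_Ioo).1 this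
  have hZ : MemLp (fun ω => φ (U ω)) ∞ P := by
    refine memLp_top_of_bound (hφm.comp_measurable hU).aestronglyMeasurable M ?_
    filter_upwards [hS] with ω hω using hM _ hω
  refine ⟨fun ω => φ (U ω), hZ, fun p hp => ?_, _, hS, fun ω hω ω' hω' h => ?_⟩
  · have hA : MeasurableSet (U ⁻¹' Ioi p) := hU measurableSet_Ioi
    have hinter : Ioi p ∩ Ioo 0 1 = Ioo p 1 := Set.ext fun q =>
      ⟨fun h => ⟨h.1, h.2.2⟩, fun h => ⟨h.1, hp.1.trans_lt h.1, h.2⟩⟩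
    have hPA : P.real (U ⁻¹' Ioi p) = 1 - p := by
      rw [measureReal_def, ← Measure.map_apply hU measurableSet_Ioi, hlaw,
        Measure.restrict_apply measurableSet_Ioi, hinter, Real.volume_Ioo,
        ENNReal.toReal_ofReal (by linarith [hp.2])]
    have h1 := setIntegral_eq_tail hZ hA hS fun ω hω ω' hω' =>
      hmono hω'.1 hω.2 ((not_lt.1 hω'.2).trans (le_of_lt hω.1))
    rw [hPA, sub_sub_cancel] at h1
    rw [← h1, ← setIntegral_map measurableSet_Ioi hφm.aestronglyMeasurable hU.aemeasurable, hlaw,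
      Measure.restrict_restrict measurableSet_Ioi, hinter, hφ p hp]
  · by_contra! hlt
    have : U ω' < U ω := by
      by_contra! hle
      exact absurd (hmono hω hω' hle) (not_le.2 hlt)
    exact absurd (hUY _ _ this) (not_le.2 h)

theorem RealProfile.tail_eq_of_hasESProfile (hγ : ∀ p ∈ Icc (0 : ℝ) 1, (γ p : EReal) = g p)
    (h : HasESProfile P X g) {p : ℝ} (hp : p ∈ Icc (0 : ℝ) 1) : tail P X p = (1 - p) * γ p := by
  rcases hp.2.eq_or_lt with rfl | h1
  · simp [tail_one]
  have := h p hp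
  rw [ES_eq_tail h1, ← hγ p hp, EReal.coe_eq_coe_iff, div_eq_iff (by linarith)] at this
  linarith

theorem RealProfile.le_of_forall_le (hγ : RealProfile γ) {M : ℝ}
    (h : ∀ p ∈ Ioo (0 : ℝ) 1, γ p ≤ M) : γ 1 ≤ M := by
  have : Tendsto γ (𝓝[<] 1) (𝓝 (γ 1)) := hγ.left 1 (by simp)
  refine le_of_tendsto this ?_
  filter_upwards [Ioo_mem_nhdsLT zero_lt_one] with p hp using h p hp

theorem RealProfile.hasESProfile_of_tail_eq [IsProbabilityMeasure P] (hγ : RealProfile γ)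
    (hγg : ∀ p ∈ Icc (0 : ℝ) 1, (γ p : EReal) = g p) (hX : MemLp X ∞ P)
    (h : ∀ p ∈ Icc (0 : ℝ) 1, tail P X p = (1 - p) * γ p) : HasESProfile P X g := by
  intro p hp
  rw [← hγg p hp]
  rcases hp.2.eq_or_lt with rfl | h1
  · refine le_antisymm (ES_one_le_iff.2 (ae_le_of_tail_le hX fun p hp => ?_)) ?_
    · rw [h p (Ioo_subset_Icc_self hp)]
      exact mul_le_mul_of_nonneg_left (hγ.mono (Ioo_subset_Icc_self hp) (by simp) hp.2.le)
        (by linarith [hp.2])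
    · refine EReal.le_of_forall_lt_iff_le.1 fun M hM => ?_
      rw [EReal.coe_le_coe_iff]
      have hM' := ES_one_le_iff.1 hM.le
      refine hγ.le_of_forall_le fun p hp => ?_
      have := tail_le_of_ae_le hX hM' (Ioo_subset_Icc_self hp)
      rw [h p (Ioo_subset_Icc_self hp)] at this
      exact le_of_mul_le_mul_left this (by linarith [hp.2])
  · rw [ES_eq_tail h1, h p hp, mul_div_cancel_left₀ _ (by linarith)]

theorem HasESProfile.congr (h : X =ᵐ[P] Y) (hX : HasESProfile P X g) : HasESProfile P Y g :=
  fun p hp => (ES_congr h p).symm.trans (hX p hp)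

theorem Comonotonic.congr_left {Z : Ω → ℝ} (h : X =ᵐ[P] Y) (hX : Comonotonic P X Z) :
    Comonotonic P Y Z := by
  obtain ⟨S, hS, hm⟩ := hX
  refine ⟨S ∩ {ω | X ω = Y ω}, inter_mem hS h, fun ω hω ω' hω' hlt => ?_⟩
  have h1 : X ω = Y ω := hω.2
  have h2 : X ω' = Y ω' := hω'.2
  rw [← h1, ← h2]
  exact hm hω.1 hω'.1 hlt

theorem IsESProfile.exists_comonotonic (hg : IsESProfile g)
    (hgb : ∃ C : ℝ, ∀ p ∈ Icc (0 : ℝ) 1, g p ≤ g 0 + ((C * p : ℝ) : EReal)) (hP : Atomless P)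
    [IsProbabilityMeasure P] (hY : Measurable Y) :
    ∃ Z : LInf P, HasESProfile P Z g ∧ Comonotonic P Z Y := by
  have hγ := hg.realProfile hgb
  obtain ⟨Z, hZ, hZt, hZY⟩ := hγ.exists_comonotonic hP hY
  have hae : Z =ᵐ[P] hZ.toLp Z := hZ.coeFn_toLp.symm
  exact ⟨hZ.toLp Z, (hγ.hasESProfile_of_tail_eq (fun p hp => hg.coe_toReal hgb hp) hZ hZt).congr hae,
    hZY.congr_left hae⟩

/-! ### The adjusted Expected Shortfall in terms of tails -/

/-- In terms of tails the condition at `p = 1` is void; the essential supremum bound is recovered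
from the levels `p < 1` and monotonicity of `γ`. -/
theorem RealProfile.mem_acceptSet_iff [IsProbabilityMeasure P] (hγ : RealProfile γ)
    (hγg : ∀ p ∈ Icc (0 : ℝ) 1, (γ p : EReal) = g p) (hX : MemLp X ∞ P) (m : ℝ) :
    (fun ω => X ω - m) ∈ acceptSet P g ↔
      ∀ p ∈ Icc (0 : ℝ) 1, tail P X p ≤ (1 - p) * (γ p + m) := by
  have hXm : MemLp (fun ω => X ω - m) ∞ P := hX.sub (memLp_const m)
  have htail : ∀ p ∈ Icc (0 : ℝ) 1,
      tail P (fun ω => X ω - m) p = tail P X p - (1 - p) * m := fun p hp => by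
    simp_rw [sub_eq_add_neg]
    rw [tail_add_const hX _ hp]
    ring
  have hES : ∀ p ∈ Icc (0 : ℝ) 1, p < 1 → (ES P p (fun ω => X ω - m) ≤ g p ↔
      tail P X p ≤ (1 - p) * (γ p + m)) := fun p hp h1 => by
    rw [ES_eq_tail h1, ← hγg p hp, EReal.coe_le_coe_iff, div_le_iff₀ (by linarith), htail p hp]
    constructor <;> intro h <;> linarith
  constructor
  · intro h p hp
    rcases hp.2.eq_or_lt with rfl | h1
    · simp [tail_one]
    · exact (hES p hp h1).1 (h.2 p hp)
  · intro h
    refine ⟨hXm.integrable le_top, fun p hp => ?_⟩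
    rcases hp.2.eq_or_lt with rfl | h1
    · rw [← hγg 1 hp]
      refine ES_one_le_iff.2 (ae_le_of_tail_le hXm fun p hp => ?_)
      have hp' := Ioo_subset_Icc_self hp
      rw [htail p hp']
      have h2 := mul_le_mul_of_nonneg_left (hγ.mono hp' (by simp) hp.2.le)
        (by linarith [hp.2] : 0 ≤ 1 - p)
      linarith [h p hp']
    · exact (hES p hp h1).2 (h p hp)

theorem RealProfile.adjES_eq_of_isLeast [IsProbabilityMeasure P] (hγ : RealProfile γ)
    (hγg : ∀ p ∈ Icc (0 : ℝ) 1, (γ p : EReal) = g p) (hX : MemLp X ∞ P) {m : ℝ}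
    (hm : IsLeast {m : ℝ | ∀ p ∈ Icc (0 : ℝ) 1, tail P X p ≤ (1 - p) * (γ p + m)} m) :
    adjES P g X = m := by
  have hset : {m : ℝ | (fun ω => X ω - m) ∈ acceptSet P g} =
      {m : ℝ | ∀ p ∈ Icc (0 : ℝ) 1, tail P X p ≤ (1 - p) * (γ p + m)} :=
    Set.ext fun m => hγ.mem_acceptSet_iff hγg hX m
  have h2 : IsLeast ((fun t : ℝ => (t : EReal)) ''
      {m : ℝ | ∀ p ∈ Icc (0 : ℝ) 1, tail P X p ≤ (1 - p) * (γ p + m)}) (m : EReal) :=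
    ⟨⟨m, hm.1, rfl⟩, by
      rintro _ ⟨t, ht, rfl⟩
      exact EReal.coe_le_coe_iff.2 (hm.2 ht)⟩
  rw [adjES, hset, h2.isGLB.sInf_eq]

theorem RealProfile.adjES_eq_of_tail_eq [IsProbabilityMeasure P] (hγ : RealProfile γ)
    (hγg : ∀ p ∈ Icc (0 : ℝ) 1, (γ p : EReal) = g p) (hX : MemLp X ∞ P) {z : ℝ}
    (h : ∀ p ∈ Icc (0 : ℝ) 1, tail P X p = (1 - p) * (γ p + z)) : adjES P g X = z := by
  refine hγ.adjES_eq_of_isLeast hγg hX ⟨fun p hp => (h p hp).le, fun m hm => ?_⟩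
  have h0 : (0 : ℝ) ∈ Icc (0 : ℝ) 1 := by simp
  have := hm 0 h0
  rw [h 0 h0] at this
  linarith

theorem RealProfile.exists_adjES_eq [IsProbabilityMeasure P] (hγ : RealProfile γ)
    (hγg : ∀ p ∈ Icc (0 : ℝ) 1, (γ p : EReal) = g p) (hX : MemLp X ∞ P) :
    ∃ m : ℝ, adjES P g X = m ∧
      ∀ p ∈ Icc (0 : ℝ) 1, tail P X p ≤ (1 - p) * (γ p + m) := by
  set S := {m : ℝ | ∀ p ∈ Icc (0 : ℝ) 1, tail P X p ≤ (1 - p) * (γ p + m)} with hS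
  obtain ⟨M, -, hM⟩ := exists_ae_abs_le hX
  have hne : S.Nonempty := by
    refine ⟨M - γ 0, fun p hp => ?_⟩
    have h1 := tail_le_of_ae_le hX (hM.mono fun ω h => (abs_le.1 h).2) hp
    have h2 := mul_le_mul_of_nonneg_left (hγ.mono (by simp) hp hp.1)
      (by linarith [hp.2] : 0 ≤ 1 - p)
    linarith
  have hlow : ∀ p ∈ Icc (0 : ℝ) 1, p < 1 → ∀ m ∈ S, tail P X p / (1 - p) - γ p ≤ m :=
    fun p hp h1 m hm => by
      have := hm p hp
      rw [mul_comm, ← div_le_iff₀ (by linarith)] at this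
      linarith
  have hmem : sInf S ∈ S := fun p hp => by
    rcases hp.2.eq_or_lt with rfl | h1
    · simp [tail_one]
    · have := le_csInf hne (hlow p hp h1)
      rw [mul_comm, ← div_le_iff₀ (by linarith)]
      linarith
  refine ⟨sInf S, hγ.adjES_eq_of_isLeast hγg hX ⟨hmem, fun m hm => ?_⟩, hmem⟩
  exact csInf_le ⟨_, fun m hm => hlow 0 (by simp) zero_lt_one m hm⟩ hm

/-! ### Prices -/

theorem price_eq [IsProbabilityMeasure P] (Q : Measure Ω) [IsProbabilityMeasure Q] (hQ : Q ≪ P)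
    (w : ℝ) (X : LInf P) :
    price Q w X = w - ∫ ω, X ω * (Q.rnDeriv P ω).toReal ∂P := by
  obtain ⟨M, -, hM⟩ := exists_ae_abs_le (Lp.memLp X)
  have hXQ : Integrable X Q :=
    (memLp_top_of_bound ((Lp.memLp X).1.mono_ac hQ) M (hQ.ae_le hM)).integrable le_top
  rw [price, integral_sub (integrable_const w) hXQ, ← integral_rnDeriv_smul hQ (f := X)]
  simp [mul_comm]

theorem coeFn_shift [IsProbabilityMeasure P] (Z : LInf P) (z : ℝ) :
    shift Z z =ᵐ[P] fun ω => Z ω + z := by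
  filter_upwards [Lp.coeFn_add Z (Lp.const ∞ P z), Lp.coeFn_const (p := ∞) (μ := P) z]
    with ω h1 h2
  rw [shift, h1, Pi.add_apply, h2]
  rfl

theorem price_shift [IsProbabilityMeasure P] (Q : Measure Ω) [IsProbabilityMeasure Q] (hQ : Q ≪ P)
    (w : ℝ) (Z : LInf P) (z : ℝ) : price Q w (shift Z z) = price Q w Z - z := by
  obtain ⟨M, -, hM⟩ := exists_ae_abs_le (Lp.memLp Z)
  have hZQ : Integrable Z Q :=
    (memLp_top_of_bound ((Lp.memLp Z).1.mono_ac hQ) M (hQ.ae_le hM)).integrable le_top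
  have h1 : ∫ ω, (w - shift Z z ω) ∂Q = ∫ ω, (w - Z ω - z) ∂Q :=
    integral_congr_ae ((hQ.ae_eq (coeFn_shift Z z)).mono fun ω h => by
      dsimp only
      rw [h]
      ring)
  have h2 : Integrable (fun ω => w - Z ω) Q := (integrable_const w).sub hZQ
  rw [price, price, h1, integral_sub h2 (integrable_const z)]
  simp

theorem tail_shift [IsProbabilityMeasure P] (Z : LInf P) (z : ℝ) {p : ℝ} (hp : p ∈ Icc (0 : ℝ) 1) :
    tail P (shift Z z) p = tail P Z p + (1 - p) * z := by
  rw [tail_congr (coeFn_shift Z z), tail_add_const (Lp.memLp Z) z hp]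

theorem Comonotonic.shift [IsProbabilityMeasure P] {Z : LInf P} (h : Comonotonic P Z Y) (z : ℝ) :
    Comonotonic P (shift Z z) Y := by
  refine Comonotonic.congr_left (coeFn_shift Z z).symm ?_
  obtain ⟨S, hS, hm⟩ := h
  exact ⟨S, hS, fun ω hω ω' hω' hlt => add_le_add_left (hm hω hω' hlt) z⟩

theorem price_le_of_tail_le [IsProbabilityMeasure P] (Q : Measure Ω) [IsProbabilityMeasure Q]
    (hQ : Q ≪ P) (w : ℝ) {X W : LInf P} (hW : Comonotonic P W (fun ω => (Q.rnDeriv P ω).toReal))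
    (h : ∀ p ∈ Icc (0 : ℝ) 1, tail P X p ≤ tail P W p) : price Q w W ≤ price Q w X := by
  rw [price_eq Q hQ, price_eq Q hQ]
  exact sub_le_sub_left (integral_mul_le_of_tail_le (Lp.memLp X) (Lp.memLp W)
    Measure.integrable_toReal_rnDeriv (Measure.measurable_rnDeriv Q P).ennreal_toReal
    (Eventually.of_forall fun ω => ENNReal.toReal_nonneg) hW h) w

/-! ### Solving the expected utility constraint -/

theorem integrable_of_expE_eq_coe {f : Ω → EReal} (hf : AEMeasurable f P) {x : ℝ}
    (h : expE P f = (x : EReal)) :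
    (∀ᵐ ω ∂P, ((f ω).toReal : EReal) = f ω) ∧ Integrable (fun ω => (f ω).toReal) P ∧
      ∫ ω, (f ω).toReal ∂P = x := by
  have hB : ∫⁻ ω, (-f ω).toENNReal ∂P ≠ ∞ := fun htop => by
    simp [expE, htop] at h
  have hA : ∫⁻ ω, (f ω).toENNReal ∂P ≠ ∞ := fun htop => by
    rw [expE, htop, ← EReal.coe_ennreal_toReal hB] at h
    simp at h
  have hcoe : ∀ᵐ ω ∂P, ((f ω).toReal : EReal) = f ω := by
    filter_upwards [ae_lt_top' hf.ereal_toENNReal hA, ae_lt_top' hf.neg.ereal_toENNReal hB]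
      with ω h1 h2
    refine EReal.coe_toReal (fun htop => ?_) (fun hbot => ?_)
    · simp [htop] at h1
    · simp [hbot] at h2
  have hint : Integrable (fun ω => (f ω).toReal) P := by
    refine ⟨hf.ereal_toReal.aestronglyMeasurable, ?_⟩
    have hle : ∀ᵐ ω ∂P, ‖(f ω).toReal‖ₑ ≤ (f ω).toENNReal + (-f ω).toENNReal := by
      filter_upwards [hcoe] with ω hω
      rw [← hω, ← EReal.coe_neg, EReal.real_coe_toENNReal, EReal.real_coe_toENNReal,
        EReal.toReal_coe, ← ofReal_norm, Real.norm_eq_abs]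
      rcases abs_choice (f ω).toReal with h | h <;> rw [h]
      exacts [le_self_add, le_add_self]
    refine (lintegral_mono_ae hle).trans_lt ?_
    rw [lintegral_add_left' hf.ereal_toENNReal]
    exact ENNReal.add_lt_top.2 ⟨hA.lt_top, hB.lt_top⟩
  refine ⟨hcoe, hint, ?_⟩
  rw [← EReal.coe_eq_coe_iff, ← h, ← expE_coe hint]
  exact expE_congr hcoe

/-- Slopes of a concave function decrease, so once `u` is flat on an interval it cannot grow further
right. -/
theorem IsUtility.le_of_eq {u : ℝ → EReal} (hu : IsUtility u) {y z t : ℝ} (hy : u y ≠ ⊥)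
    (hyz : y < z) (h : u z = u y) : u t ≤ u y := by
  rcases le_or_gt t z with htz | htz
  · exact h ▸ hu.2.1 htz
  have ht := hu.ne_bot_of_le hy (hyz.trans htz).le
  have hz := hu.ne_bot_of_le hy hyz.le
  have h1 := hu.concaveOn_toReal.slope_anti_adjacent hy ht hyz htz
  rw [h, sub_self, zero_div, div_le_iff₀ (by linarith)] at h1
  rw [← hu.coe_toReal ht, ← hu.coe_toReal hy, EReal.coe_le_coe_iff]
  linarith

/-- Here `M` is the essential supremum of `Z`. The solution is the largest `z` at which the expected
utility is still at least `x`. -/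
theorem IsUtility.existsUnique_shift [IsProbabilityMeasure P] {u : ℝ → EReal} (hu : IsUtility u)
    {Z : Ω → ℝ} (hZ : MemLp Z ∞ P) (w x : ℝ) {lo hi : EReal} (hlo : Tendsto u atBot (𝓝 lo))
    (hhi : Tendsto u atTop (𝓝 hi)) (hlox : lo < x) (hxhi : x < hi) {M : ℝ}
    (hM : ∀ M' : ℝ, (∀ᵐ ω ∂P, Z ω ≤ M') ↔ M ≤ M')
    (hbd : ∀ a : ℝ, IsGLB {y : ℝ | u y ≠ ⊥} a → expE P (fun ω => u (a + M - Z ω)) ≤ (x : EReal)) :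
    ∃ z : ℝ, ∀ z' : ℝ, expE P (fun ω => u (w - (Z ω + z'))) = (x : EReal) ↔ z' = z := by
  have hum : Measurable u := hu.2.1.measurable
  have hmeas : ∀ z, AEMeasurable (fun ω => u (w - (Z ω + z))) P := fun z =>
    hum.comp_aemeasurable ((hZ.1.aemeasurable.add_const z).const_sub w)
  set φ : ℝ → EReal := fun z => expE P (fun ω => u (w - (Z ω + z))) with hφ
  have hanti : Antitone φ := fun z z' h =>
    expE_mono (Eventually.of_forall fun ω => hu.2.1 (by linarith))
  -- Two solutions force `u` to be almost surely flat between the two arguments, hence equal to its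
  -- limit `hi` there. The expected utility would be `hi`, which exceeds `x`.
  have huniq : ∀ z z', φ z = (x : EReal) → φ z' = (x : EReal) → ¬ z < z' := by
    intro z z' hz hz' hlt
    obtain ⟨c1, i1, e1⟩ := integrable_of_expE_eq_coe (hmeas z) hz
    obtain ⟨c2, i2, e2⟩ := integrable_of_expE_eq_coe (hmeas z') hz'
    have hle : (fun ω => (u (w - (Z ω + z'))).toReal) ≤ᵐ[P]
        fun ω => (u (w - (Z ω + z))).toReal := by
      filter_upwards [c1, c2] with ω h1 h2
      rw [← EReal.coe_le_coe_iff, h1, h2]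
      exact hu.2.1 (by linarith)
    have heq := (integral_eq_iff_of_ae_le i2 i1 hle).1 (e2.trans e1.symm)
    have hconst : (fun ω => u (w - (Z ω + z'))) =ᵐ[P] fun _ => hi := by
      filter_upwards [c1, c2, heq] with ω h1 h2 h3
      have hne : u (w - (Z ω + z')) ≠ ⊥ := by
        rw [← h2]
        exact EReal.coe_ne_bot _
      have h4 : u (w - (Z ω + z)) = u (w - (Z ω + z')) := by rw [← h1, ← h2, h3]
      refine tendsto_nhds_unique (tendsto_const_nhds.congr' ?_) hhi
      filter_upwards [eventually_ge_atTop (w - (Z ω + z'))] with t ht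
      exact le_antisymm (hu.2.1 ht) (hu.le_of_eq hne (by linarith) h4)
    have : φ z' = hi := (expE_congr hconst).trans (expE_const hi)
    rw [hz'] at this
    exact hxhi.ne this
  suffices hex : ∃ z, φ z = (x : EReal) by
    obtain ⟨z, hz⟩ := hex
    refine ⟨z, fun z' => ⟨fun h => ?_, fun h => h ▸ hz⟩⟩
    exact le_antisymm (not_lt.1 (huniq _ _ hz h)) (not_lt.1 (huniq _ _ h hz))
  obtain ⟨B, -, hB⟩ := exists_ae_abs_le hZ
  have hle : ∀ z, φ z ≤ u (w + B - z) := fun z =>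
    (expE_mono (hB.mono fun ω h => hu.2.1 (by linarith [(abs_le.1 h).1]))).trans_eq
      (expE_const _)
  have hge : ∀ z, u (w - B - z) ≤ φ z := fun z =>
    (expE_const (P := P) _).symm.trans_le
      (expE_mono (hB.mono fun ω h => hu.2.1 (by linarith [(abs_le.1 h).2])))
  set S := {z | (x : EReal) ≤ φ z} with hS
  have hne : S.Nonempty := by
    obtain ⟨y, hy⟩ := (hhi.eventually (lt_mem_nhds hxhi)).exists
    refine ⟨w - B - y, (hy.le.trans_eq ?_).trans (hge _)⟩
    congr 1
    ring
  have hbdd : BddAbove S := by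
    obtain ⟨y, hy⟩ := (hlo.eventually (gt_mem_nhds hlox)).exists
    refine ⟨w + B - y, fun z hz => ?_⟩
    by_contra! hlt
    exact absurd ((show (x : EReal) ≤ φ z from hz).trans ((hle z).trans (hu.2.1 (by linarith))))
      (not_le.2 hy)
  set s := sSup S with hs
  have hφs : (x : EReal) ≤ φ s := by
    set c : ℕ → ℝ := fun n => s - 1 / ((n : ℝ) + 1) with hc
    have hcmono : Monotone c := fun m n hmn => sub_le_sub_left (Nat.one_div_le_one_div hmn) _
    have hclim : Tendsto c atTop (𝓝 s) := by
      have := (tendsto_const_nhds (x := s)).sub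
        (tendsto_one_div_add_atTop_nhds_zero_nat (𝕜 := ℝ))
      rwa [sub_zero] at this
    have hcs : ∀ n, c n < s := fun n => by
      have : (0 : ℝ) < 1 / ((n : ℝ) + 1) := by positivity
      simp only [hc]
      linarith
    have hlim : Tendsto (fun n => φ (c n)) atTop (𝓝 (φ s)) := by
      refine tendsto_expE_of_antitone (M := (u (w + B - c 0)).toReal) (fun n => hmeas (c n))
        (fun n => ?_) ?_ ?_
      · filter_upwards [hB] with ω hω
        refine (hu.2.1 ?_).trans (EReal.le_coe_toReal (hu.1 _))
        linarith [(abs_le.1 hω).1, hcmono (Nat.zero_le n)]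
      · exact Eventually.of_forall fun ω m n hmn => hu.2.1 (by linarith [hcmono hmn])
      · refine Eventually.of_forall fun ω => ?_
        have h1 : Tendsto (fun n => w - (Z ω + c n)) atTop (𝓝 (w - (Z ω + s))) :=
          (hclim.const_add _).const_sub w
        exact (hu.2.2.2 _).tendsto.comp
          (tendsto_nhdsWithin_of_tendsto_nhds_of_eventually_within _ h1
            (Eventually.of_forall fun n => by
              show w - (Z ω + s) ≤ w - (Z ω + c n)
              linarith [hcs n]))
    refine ge_of_tendsto' hlim fun n => ?_
    obtain ⟨z, hz, hlt⟩ := exists_lt_of_lt_csSup hne (hcs n)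
    exact (show (x : EReal) ≤ φ z from hz).trans (hanti hlt.le)
  refine ⟨s, le_antisymm ?_ hφs⟩
  by_contra! hlt
  -- If the value at `s` exceeds `x`, the aim is a `z₁ > s` with finite expected utility. With `a`
  -- the left end of the domain, `M = w - s - a` would make the value at `s` the one bounded by
  -- `hbd`; so `M < w - s - a`, which leaves room to move right.
  obtain ⟨z₁, y, hz₁, hy, hyZ⟩ : ∃ z₁ y, s < z₁ ∧ u y ≠ ⊥ ∧ ∀ᵐ ω ∂P, y ≤ w - (Z ω + z₁) := by
    by_cases hall : ∀ y, u y ≠ ⊥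
    · exact ⟨s + 1, w - (B + (s + 1)), by linarith, hall _, hB.mono fun ω h => by
        linarith [(abs_le.1 h).2]⟩
    push Not at hall
    obtain ⟨y₀, hy₀⟩ := hall
    have hsne := ne_bot_of_expE_ne_bot (hmeas s) (ne_bot_of_gt hlt)
    have hIne : {y | u y ≠ ⊥}.Nonempty := hsne.exists.imp' _ fun _ h => h
    have hIbd : BddBelow {y | u y ≠ ⊥} := ⟨y₀, fun y hy => le_of_not_gt fun hlt =>
      hu.ne_bot_of_le hy hlt.le hy₀⟩
    set a := sInf {y | u y ≠ ⊥}
    have hMs : M ≤ w - s - a := (hM _).1 (hsne.mono fun ω h => by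
      have : a ≤ w - (Z ω + s) := csInf_le hIbd h
      linarith)
    have hne' : M ≠ w - s - a := fun heq => by
      have := hbd a (isGLB_csInf hIne hIbd)
      refine absurd (hlt.trans_le ?_) (lt_irrefl (x : EReal))
      refine Eq.trans_le ?_ this
      simp only [hφ]
      congr 1
      funext ω
      congr 1
      linarith
    have hlt' := lt_of_le_of_ne hMs hne'
    obtain ⟨y, hy, hya⟩ := exists_lt_of_csInf_lt hIne
      (show a < w - M - (s + (w - M - a)) / 2 by linarith)
    refine ⟨(s + (w - M - a)) / 2, y, by linarith, hy, ((hM M).2 le_rfl).mono fun ω h => ?_⟩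
    linarith
  have hreal : ∀ z, φ z ≠ ⊥ → ((φ z).toReal : EReal) = φ z := fun z hz =>
    EReal.coe_toReal (ne_top_of_le_ne_top (hu.1 _) (hle z)) hz
  have hφ₁ : φ z₁ ≠ ⊥ := fun hbot => hy (le_bot_iff.1 (hbot ▸
    (expE_const (P := P) _).symm.trans_le (expE_mono (hyZ.mono fun ω h => hu.2.1 h))))
  obtain ⟨c0, i0, e0⟩ := integrable_of_expE_eq_coe (hmeas s) (hreal s (ne_bot_of_gt hlt)).symm
  obtain ⟨c1, i1, e1⟩ := integrable_of_expE_eq_coe (hmeas z₁) (hreal z₁ hφ₁).symm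
  have hr : x < (φ s).toReal := by
    rw [← EReal.coe_lt_coe_iff, hreal s (ne_bot_of_gt hlt)]
    exact hlt
  have hr₁ : (φ z₁).toReal < x := by
    rw [← EReal.coe_lt_coe_iff, hreal z₁ hφ₁]
    by_contra! h
    exact absurd (le_csSup hbdd h) (not_le.2 hz₁)
  set r := (φ s).toReal
  set r₁ := (φ z₁).toReal
  -- The weight with `t * r₁ + (1 - t) * r = x`. By concavity the corresponding mixture of `z₁` and
  -- `s` still reaches `x`, although it lies beyond the supremum `s`.
  set t := (r - x) / (r - r₁) with ht
  have hrr : 0 < r - r₁ := by linarith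
  have ht0 : 0 < t := div_pos (by linarith) hrr
  have ht1 : t < 1 := (div_lt_one hrr).2 (by linarith)
  have htr : t * (r - r₁) = r - x := div_mul_cancel₀ _ hrr.ne'
  have hmem : t * z₁ + (1 - t) * s ∈ S := by
    show (x : EReal) ≤ φ _
    have h1 : (x : EReal) = expE P (fun ω => ((t * (u (w - (Z ω + z₁))).toReal +
        (1 - t) * (u (w - (Z ω + s))).toReal : ℝ) : EReal)) := by
      rw [expE_coe (f := fun ω => t * (u (w - (Z ω + z₁))).toReal +
          (1 - t) * (u (w - (Z ω + s))).toReal) ((i1.const_mul t).add (i0.const_mul (1 - t))),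
        integral_add (i1.const_mul t) (i0.const_mul (1 - t)), integral_const_mul,
        integral_const_mul, e0, e1, EReal.coe_eq_coe_iff]
      linarith
    rw [h1]
    refine expE_mono ?_
    filter_upwards [c0, c1] with ω h2 h3
    have h4 := hu.2.2.1 (w - (Z ω + z₁)) (w - (Z ω + s)) t ht0 ht1
    rw [← h2, ← h3] at h4
    refine Eq.trans_le ?_ (h4.trans_eq ?_)
    · push_cast
      rfl
    · congr 1
      ring
  have hgt : s < t * z₁ + (1 - t) * s := by nlinarith
  exact absurd (le_csSup hbdd hmem) (not_le.2 hgt)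

end AdjES

end

/-! ### Optimality in the five problems -/

open AdjES
theorem mainTheorem3 {Ω : Type*} [MeasurableSpace Ω]
    (P : Measure Ω) [IsProbabilityMeasure P] (hP : Atomless P)
    (Q : Measure Ω) [IsProbabilityMeasure Q] (hQ : Q ≪ P)
    (g : ℝ → EReal) (hg : IsESProfile g)
    (hgb : ∃ C : ℝ, ∀ p ∈ Icc (0 : ℝ) 1, g p ≤ g 0 + ((C * p : ℝ) : EReal))
    (w x : ℝ) :
    -- there is a bounded `Z` with ES profile `g` that is comonotonic with `dQ/dP`
    (∃ Z : LInf P, HasESProfile P Z g ∧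
      Comonotonic P Z (fun ω => (Q.rnDeriv P ω).toReal)) ∧
    ∀ Z : LInf P, HasESProfile P Z g →
      (Comonotonic P Z (fun ω => (Q.rnDeriv P ω).toReal) →
        -- (A)
        (∃ z : ℝ,
          Minimizes (rho g) {X : LInf P | price Q w X ≤ x} (shift Z z) ∧
          ∀ z' : ℝ, price Q w (shift Z z') = x ↔ z' = z) ∧
        -- (B)
        (∃ z : ℝ,
          Minimizes (fun X : LInf P => (price Q w X : EReal))
            {X : LInf P | rho g X ≤ (x : EReal)} (shift Z z) ∧
          ∀ z' : ℝ, rho g (shift Z z') = (x : EReal) ↔ z' = z)) ∧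
      -- (C); the last hypothesis is vacuous when `u` is finite everywhere, and otherwise bounds from
      -- above the utility of the largest loss `Z + z` that stays in the (closed) domain of `u`
      (∀ u : ℝ → EReal, IsUtility u →
        ∀ lo hi : EReal, Tendsto u atBot (𝓝 lo) → Tendsto u atTop (𝓝 hi) →
        lo < (x : EReal) → (x : EReal) < hi →
        (∀ a : ℝ, IsGLB {y : ℝ | u y ≠ ⊥} a →
          expE P (fun ω => u (a + (g 1).toReal - Z ω)) ≤ (x : EReal)) →
        ∃ z : ℝ,
          Minimizes (rho g) {X : LInf P | expUtil u w X = (x : EReal)} (shift Z z) ∧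
          ∀ z' : ℝ, expUtil u w (shift Z z') = (x : EReal) ↔ z' = z) ∧
      -- (D)
      (∀ u : ℝ → EReal, IsUtility u →
        ∃ z : ℝ,
          Minimizes (expUtil u w) {X : LInf P | rho g X = (x : EReal)} (shift Z z) ∧
          ∀ z' : ℝ, rho g (shift Z z') = (x : EReal) ↔ z' = z) ∧
      -- (E)
      (∀ ρ' : LInf P → EReal,
        (∀ X Y : LInf P, SSD P X Y → ρ' X ≤ ρ' Y) → Continuous ρ' →
        ∃ z : ℝ,
          Maximizes ρ' {X : LInf P | rho g X = (x : EReal)} (shift Z z) ∧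
          ∀ z' : ℝ, rho g (shift Z z') = (x : EReal) ↔ z' = z) := by
  have hγ := hg.realProfile hgb
  have hγg : ∀ p ∈ Icc (0 : ℝ) 1, (((g p).toReal : ℝ) : EReal) = g p := fun p hp =>
    hg.coe_toReal hgb hp
  refine ⟨hg.exists_comonotonic hgb hP (Measure.measurable_rnDeriv Q P).ennreal_toReal,
    fun Z hZ => ?_⟩
  have htail : ∀ z, ∀ p ∈ Icc (0 : ℝ) 1,
      tail P (shift Z z) p = (1 - p) * ((g p).toReal + z) := fun z p hp => by
    rw [tail_shift Z z hp, RealProfile.tail_eq_of_hasESProfile hγg hZ hp, mul_add]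
  have hrho : ∀ z : ℝ, rho g (shift Z z) = (z : EReal) := fun z =>
    hγ.adjES_eq_of_tail_eq hγg (Lp.memLp _) (htail z)
  have hrho_iff : ∀ z' : ℝ, rho g (shift Z z') = (x : EReal) ↔ z' = x := fun z' => by
    rw [hrho, EReal.coe_eq_coe_iff]
  -- The key domination: once `z` is at least the risk of `X`, `Z + z` has larger tails than `X`.
  have hdom : ∀ X : LInf P, ∃ m : ℝ, rho g X = (m : EReal) ∧
      ∀ z, m ≤ z → ∀ p ∈ Icc (0 : ℝ) 1, tail P X p ≤ tail P (shift Z z) p := fun X => by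
    obtain ⟨m, hm, h⟩ := hγ.exists_adjES_eq hγg (Lp.memLp X)
    refine ⟨m, hm, fun z hz p hp => (h p hp).trans ?_⟩
    rw [htail z p hp]
    exact mul_le_mul_of_nonneg_left (by linarith) (by linarith [hp.2])
  have hutil : ∀ u, IsUtility u → ∀ (X : LInf P) (m : ℝ), rho g X = (m : EReal) →
      expUtil u w (shift Z m) ≤ expUtil u w X := fun u hu X m hm => by
    obtain ⟨m', hm', h⟩ := hdom X
    obtain rfl : m' = m := EReal.coe_eq_coe_iff.1 (hm'.symm.trans hm)
    exact expE_utility_le_of_tail_le hu (Lp.memLp X) (Lp.memLp _) (h m' le_rfl) w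
  refine ⟨fun hZQ => ⟨?_, ?_⟩, ?_, ?_, ?_⟩
  · refine ⟨price Q w Z - x, ⟨?_, fun X hX => ?_⟩, fun z' => ?_⟩
    · exact (by rw [price_shift Q hQ]; linarith : price Q w (shift Z (price Q w Z - x)) ≤ x)
    · obtain ⟨m, hm, h⟩ := hdom X
      rw [hrho, hm, EReal.coe_le_coe_iff]
      have h1 := price_le_of_tail_le Q hQ w (hZQ.shift m) (h m le_rfl)
      rw [price_shift Q hQ] at h1
      have h2 : price Q w X ≤ x := hX
      linarith
    · rw [price_shift Q hQ]
      constructor <;> intro h <;> linarith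
  · refine ⟨x, ⟨(hrho x).le, fun X hX => ?_⟩, hrho_iff⟩
    obtain ⟨m, hm, h⟩ := hdom X
    have hmx : rho g X ≤ (x : EReal) := hX
    rw [hm, EReal.coe_le_coe_iff] at hmx
    exact EReal.coe_le_coe_iff.2 (price_le_of_tail_le Q hQ w (hZQ.shift x) (h x hmx))
  · intro u hu lo hi hlo hhi hlox hxhi hbd
    have hM : ∀ M' : ℝ, (∀ᵐ ω ∂P, Z ω ≤ M') ↔ (g 1).toReal ≤ M' := fun M' => by
      rw [← ES_one_le_iff, hZ 1 (by simp), ← hγg 1 (by simp), EReal.coe_le_coe_iff,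
        EReal.toReal_coe]
    obtain ⟨z, hz⟩ := hu.existsUnique_shift (Lp.memLp Z) w x hlo hhi hlox hxhi hM hbd
    have hshift : ∀ z', expUtil u w (shift Z z') = expE P (fun ω => u (w - (Z ω + z'))) :=
      fun z' => expE_congr ((coeFn_shift Z z').mono fun ω h => by
        dsimp only
        rw [h])
    simp_rw [← hshift] at hz
    refine ⟨z, ⟨(hz z).2 rfl, fun X hX => ?_⟩, hz⟩
    obtain ⟨m, hm, -⟩ := hdom X
    rw [hrho, hm, EReal.coe_le_coe_iff]
    -- If `X` had risk `m < z`, then `Z + m` would have expected utility at most `x` by domination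
    -- and at least `x` by monotonicity of `u`, giving a second solution of the constraint.
    by_contra! hlt
    have h1 : expUtil u w (shift Z m) ≤ (x : EReal) := (hutil u hu X m hm).trans_eq hX
    have h2 : (x : EReal) ≤ expUtil u w (shift Z m) := by
      rw [← (hz z).2 rfl, hshift, hshift]
      exact expE_mono (Eventually.of_forall fun ω => hu.2.1 (by linarith))
    exact hlt.ne ((hz m).1 (le_antisymm h1 h2))
  · exact fun u hu => ⟨x, ⟨hrho x, fun X hX => hutil u hu X x hX⟩, hrho_iff⟩
  · intro ρ' hρ' _
    refine ⟨x, ⟨hrho x, fun X hX => ?_⟩, hrho_iff⟩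
    obtain ⟨m, hm, h⟩ := hdom X
    have hmx : m ≤ x := (EReal.coe_eq_coe_iff.1 (hm.symm.trans hX)).le
    exact hρ' _ _ (SSD_of_tail_le (Lp.memLp X) (Lp.memLp _) (h x hmx))
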